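/- Let $q$ be a prime power, $k\ge 2$, $r\ge 2$ and $n=2rk$, and regard $\mathbb F_q\subseteq\mathbb F_{q^k}\subseteq\mathbb F_{q^n}$. Let $p_0=1$ if $r=2$, and $p_0=\max\{i\in\mathbb N^+ : \lceil r/i\rceil-1>\lfloor r/(i+1)\rfloor\}$ if $r\ge 3$. Let $\xi$ be a primitive element of $\mathbb F_{q^k}$ (a generator of $\mathbb F_{q^k}^*$), let $f$ be a monic irreducible polynomial of degree $2r$ over $\mathbb F_{q^k}$, and let $\gamma\in\mathbb F_{q^n}$ be a root of $f$. Then there is a set $A\subseteq\mathbb F_{q^k}^*$ with $|A|=\lfloor (q^k-2)/2\rfloor$ such that $f(0)\alpha\beta\ne 1$ for all $\alpha,\beta\in A$. Moreover, for every such $A$ the following holds. For $\delta_1,\dots,\delta_{r-1}\in\mathbb F_{q^k}^*$, $\delta_r\in A$, $\theta\in\{1,\xi,\dots,\xi^{q-2}\}$ and integers $1\le p\le p_0$ and $l$, where $1\le l\le r-1$ if $p=1$ and $\frac r{p+1}<l<\frac rp$ if $p\ge 2$, put $$U^{p}_{\delta_1,\dots,\delta_r,\theta,l}=\Big\{u+\sum_{a=1}^{p}(\theta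 u^q+u)\delta_{al}\gamma^{al}+\sum_{\substack{1\le b\le r\\ b\notin\{l,2l,\dots,pl\}}}u\,\delta_b\gamma^b : u\in\mathbb F_{q^k}\Big\},$$ and for $\delta_1,\dots,\delta_{r-1}\in\mathbb F_{q^k}^*$, $\delta_r\in A$ and $1\le l\le r-1$ put $$V_{\delta_1,\dots,\delta_r,l}=\Big\{v+v^q\gamma^l+\sum_{\substack{1\le b\le r\\ b\ne l}}v\,\delta_b\gamma^b : v\in\mathbb F_{q^k}\Big\}.$$ All these $\mathbb F_q$-subspaces $W$ of $\mathbb F_{q^n}$ are Sidon spaces: if $a,b,c,d\in W\setminus\{0\}$ and $ab=cd$, then $\{a\mathbb F_q,b\mathbb F_q\}=\{c\mathbb F_q,d\mathbb F_q\}$. The union $\mathcal C$ of their orbits $\{\alpha W:\alpha\in\mathbb F_{q^n}^*\}$ is a cyclic $(n,2k-2,k)_q$ constant dimension code; that is, $\mathcal C$ is a nonempty set of $k$-dimensional $\mathbb F_q$-subspaces of $\mathbb F_{q^n}$, it is stable under $X\mapsto\alpha X$ for every $\alpha\in\mathbb F_{q^n}^*$, and its minimum distance, i.e. the minimum of $d(X,Y)=\dim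 X+\dim Y-2\dim(X\cap Y)$ over distinct $X,Y\in\mathcal C$, equals $2k-2$. Its size is $$|\mathcal C|=\frac{\Big(\big(r-1+\sum_{i=2}^{p_0}(\lceil \frac ri\rceil-\lfloor\frac r{i+1}\rfloor-1)\big)(q^k-1)(q-1)+r-1\Big)(q^k-1)^{r-2}\lfloor\frac{q^k-2}{2}\rfloor(q^n-1)}{q-1}.$$ -/

import Mathlib

open scoped Polynomial

/-- `F_q`-subspaces of `L = F_{q^n}`: the Sidon property. If `a b = c d` with `a, b, c, d ∈ U`
nonzero, then `{a F_q, b F_q} = {c F_q, d F_q}`. -/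
def IsSidonSpace {F L : Type*} [Field F] [Field L] [Algebra F L] (U : Submodule F L) : Prop :=
  ∀ a ∈ U, ∀ b ∈ U, ∀ c ∈ U, ∀ d ∈ U, a ≠ 0 → b ≠ 0 → c ≠ 0 → d ≠ 0 → a * b = c * d →
    ({Submodule.span F {a}, Submodule.span F {b}} : Set (Submodule F L)) =
      {Submodule.span F {c}, Submodule.span F {d}}

/-- The cyclic shift `α U = {α u : u ∈ U}` by `α ∈ L*`. -/
def cyclicShift {F L : Type*} [Field F] [Field L] [Algebra F L] (α : Lˣ) (U : Submodule F L) :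
    Submodule F L :=
  U.map (LinearMap.mulLeft F (α : L))

/-- `orb(U) = {α U : α ∈ L*}`. -/
def cyclicOrbit {F L : Type*} [Field F] [Field L] [Algebra F L] (U : Submodule F L) :
    Set (Submodule F L) :=
  {W | ∃ α : Lˣ, W = cyclicShift α U}

/-- The subspace distance `dim U + dim V - 2 dim (U ∩ V)` (the subtraction never truncates,
as long as the ambient space is finite-dimensional). -/
noncomputable def subspaceDist {F L : Type*} [Field F] [Field L] [Algebra F L]
    (U V : Submodule F L) : ℕ :=
  Module.finrank F U + Module.finrank F V - 2 * Module.finrank F ↥(U ⊓ V)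

/-- `C` is a cyclic `(n, d, k)_q`-constant dimension code, made of `F`-subspaces of `L`,
where `F = F_q` and `L = F_{q^n}`: it is nonempty, all its members have dimension `k`,
its minimum distance (over pairs of distinct members) is exactly `d`, and it is stable under
all cyclic shifts. -/
structure IsCyclicCDC {F L : Type*} [Field F] [Field L] [Algebra F L] (n d k : ℕ)
    (C : Set (Submodule F L)) : Prop where
  finrank_ambient : Module.finrank F L = n
  nonempty : C.Nonempty
  finrank_eq : ∀ U ∈ C, Module.finrank F U = k
  minDist : IsLeast {m : ℕ | ∃ U ∈ C, ∃ V ∈ C, U ≠ V ∧ m = subspaceDist U V} d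
  cyclic : ∀ U ∈ C, ∀ α : Lˣ, cyclicShift α U ∈ C

/-- The parameter `p₀` attached to `r`: it is `1` for `r = 2`, and otherwise the largest positive
integer `i` with `⌈r / i⌉ - 1 > ⌊r / (i + 1)⌋`. -/
noncomputable def pZero (r : ℕ) : ℕ :=
  if r = 2 then 1
  else sSup {i : ℕ | 0 < i ∧ ⌈(r : ℚ) / i⌉ - 1 > ⌊(r : ℚ) / (i + 1)⌋}

/-- For `r ≥ 3` the supremum in the definition of `pZero` is a maximum. -/
theorem pZero_isGreatest {r : ℕ} (hr : 3 ≤ r) :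
    IsGreatest {i : ℕ | 0 < i ∧ ⌈(r : ℚ) / i⌉ - 1 > ⌊(r : ℚ) / (i + 1)⌋} (pZero r) := by
  have hr2 : r ≠ 2 := by omega
  rw [pZero, if_neg hr2]
  have hne : {i : ℕ | 0 < i ∧ ⌈(r : ℚ) / i⌉ - 1 > ⌊(r : ℚ) / (i + 1)⌋}.Nonempty := by
    refine ⟨1, one_pos, ?_⟩
    have h3 : (3 : ℚ) ≤ r := by exact_mod_cast hr
    have h1 : ⌈(r : ℚ) / ((1 : ℕ) : ℚ)⌉ = (r : ℤ) := by simp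
    rw [h1, gt_iff_lt, Int.floor_lt]
    push_cast
    linarith
  have hbdd : BddAbove {i : ℕ | 0 < i ∧ ⌈(r : ℚ) / i⌉ - 1 > ⌊(r : ℚ) / (i + 1)⌋} := by
    refine ⟨r, ?_⟩
    rintro i ⟨hi, h⟩
    by_contra! hlt
    have hi' : (0 : ℚ) < i := by exact_mod_cast hi
    have hlt' : (r : ℚ) < i := by exact_mod_cast hlt
    have h1 : ⌈(r : ℚ) / i⌉ ≤ 1 := by
      rw [Int.ceil_le]
      push_cast
      rw [div_le_one hi']
      exact hlt'.le
    have h2 : 0 ≤ ⌊(r : ℚ) / (i + 1)⌋ := Int.floor_nonneg.mpr (by positivity)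
    omega
  exact ⟨Nat.sSup_mem hne hbdd, fun i hi => le_csSup hbdd hi⟩

section Spaces

variable {F K L : Type*} [Field F] [Fintype F] [Field K] [Field L] [Algebra F K] [Algebra F L]
  [Algebra K L] [IsScalarTower F K L]

/-- The general member of `U^p_{δ₁,…,δ_r,θ,l}`, where `q = |F|`. Only the entries
`δ 1, …, δ r` of the sequence `δ` occur when `p * l ≤ r`. -/
def elemU (γ : L) (r p l : ℕ) (θ : K) (δ : ℕ → Kˣ) (u : K) : L :=
  algebraMap K L u
    + ∑ a ∈ Finset.Icc 1 p,
        algebraMap K L ((θ * u ^ Fintype.card F + u) * (δ (a * l) : K)) * γ ^ (a * l)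
    + ∑ b ∈ Finset.Icc 1 r \ (Finset.Icc 1 p).image (fun a => a * l),
        algebraMap K L (u * (δ b : K)) * γ ^ b

/-- The general member of `V_{δ₁,…,δ_r,l}`, where `q = |F|`. -/
def elemV (γ : L) (r l : ℕ) (δ : ℕ → Kˣ) (v : K) : L :=
  algebraMap K L v + algebraMap K L (v ^ Fintype.card F) * γ ^ l
    + ∑ b ∈ Finset.Icc 1 r \ {l}, algebraMap K L (v * (δ b : K)) * γ ^ b

theorem add_pow_card_of_algebra (u v : K) :
    (u + v) ^ Fintype.card F = u ^ Fintype.card F + v ^ Fintype.card F :=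
  map_add (FiniteField.frobeniusAlgHom F K) u v

theorem smul_pow_card_of_algebra (c : F) (u : K) :
    (c • u) ^ Fintype.card F = c • u ^ Fintype.card F :=
  map_smul (FiniteField.frobeniusAlgHom F K) c u

/-- The `F_q`-subspace `U^p_{δ₁,…,δ_r,θ,l} = {elemU u : u ∈ F_{q^k}}`. -/
def spaceU (F : Type*) {K L : Type*} [Field F] [Fintype F] [Field K] [Field L] [Algebra F K]
    [Algebra F L] [Algebra K L] [IsScalarTower F K L]
    (γ : L) (r p l : ℕ) (θ : K) (δ : ℕ → Kˣ) : Submodule F L where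
  carrier := {x | ∃ u : K, x = elemU (F := F) γ r p l θ δ u}
  add_mem' := by
    rintro _ _ ⟨u, rfl⟩ ⟨v, rfl⟩
    refine ⟨u + v, ?_⟩
    have h1 : ∀ a : ℕ, (θ * (u ^ Fintype.card F + v ^ Fintype.card F) + (u + v)) * (δ a : K)
        = (θ * u ^ Fintype.card F + u) * (δ a : K)
          + (θ * v ^ Fintype.card F + v) * (δ a : K) := fun a => by ring
    simp only [elemU, add_pow_card_of_algebra (F := F), h1, add_mul u v, map_add]
    simp only [add_mul, Finset.sum_add_distrib]
    ring
  zero_mem' := ⟨0, by simp [elemU]⟩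
  smul_mem' := by
    rintro c _ ⟨u, rfl⟩
    refine ⟨c • u, ?_⟩
    have h1 : ∀ a : ℕ, (θ * (c • u ^ Fintype.card F) + c • u) * (δ a : K)
        = c • ((θ * u ^ Fintype.card F + u) * (δ a : K)) := fun a => by
      simp only [Algebra.smul_def]; ring
    have h2 : ∀ x : K, algebraMap K L (c • x) = c • algebraMap K L x := fun x =>
      map_smul (IsScalarTower.toAlgHom F K L) c x
    simp only [elemU, smul_pow_card_of_algebra (F := F), h1, smul_mul_assoc, h2, smul_add,
      Finset.smul_sum]

/-- The `F_q`-subspace `V_{δ₁,…,δ_r,l} = {elemV v : v ∈ F_{q^k}}`. -/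
def spaceV (F : Type*) {K L : Type*} [Field F] [Fintype F] [Field K] [Field L] [Algebra F K]
    [Algebra F L] [Algebra K L] [IsScalarTower F K L]
    (γ : L) (r l : ℕ) (δ : ℕ → Kˣ) : Submodule F L where
  carrier := {x | ∃ v : K, x = elemV (F := F) γ r l δ v}
  add_mem' := by
    rintro _ _ ⟨u, rfl⟩ ⟨v, rfl⟩
    refine ⟨u + v, ?_⟩
    simp only [elemV, add_pow_card_of_algebra (F := F), add_mul u v, map_add]
    simp only [add_mul, Finset.sum_add_distrib]
    ring
  zero_mem' := ⟨0, by simp [elemV]⟩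
  smul_mem' := by
    rintro c _ ⟨u, rfl⟩
    refine ⟨c • u, ?_⟩
    have h2 : ∀ x : K, algebraMap K L (c • x) = c • algebraMap K L x := fun x =>
      map_smul (IsScalarTower.toAlgHom F K L) c x
    simp only [elemV, smul_pow_card_of_algebra (F := F), smul_mul_assoc, h2, smul_add,
      Finset.smul_sum]

end Spaces

/-- The admissible pairs `(p, l)`: `1 ≤ p ≤ p₀`, and `1 ≤ l ≤ r - 1` if `p = 1`,
`r / (p + 1) < l < r / p` otherwise. -/
def IsAdmissiblePair (r p l : ℕ) : Prop :=
  1 ≤ p ∧ p ≤ pZero r ∧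
    if p = 1 then 1 ≤ l ∧ l < r
    else (r : ℚ) / (p + 1) < l ∧ (l : ℚ) < (r : ℚ) / p

/-- `A ⊆ K*` has exactly `m` elements, and `c α β ≠ 1` for all `α, β ∈ A`. -/
def IsAvoidingSet {K : Type*} [Field K] (c : K) (m : ℕ) (A : Finset Kˣ) : Prop :=
  A.card = m ∧ ∀ α ∈ A, ∀ β ∈ A, c * (α : K) * (β : K) ≠ 1

/-- All the subspaces `U^p_{δ₁,…,δ_r,θ,l}` with `δ₁, …, δ_{r-1} ∈ K*`, `δ_r ∈ A`,
`θ ∈ {1, ξ, …, ξ^{q-2}}` and `(p, l)` admissible. -/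
def familyU (F : Type*) {K L : Type*} [Field F] [Fintype F] [Field K] [Field L] [Algebra F K]
    [Algebra F L] [Algebra K L] [IsScalarTower F K L]
    (γ : L) (r : ℕ) (ξ : Kˣ) (A : Finset Kˣ) : Set (Submodule F L) :=
  {W | ∃ (p l j : ℕ) (δ : ℕ → Kˣ), IsAdmissiblePair r p l ∧ j < Fintype.card F - 1 ∧ δ r ∈ A ∧
    W = spaceU F γ r p l ((ξ : K) ^ j) δ}

/-- All the subspaces `V_{δ₁,…,δ_r,l}` with `δ₁, …, δ_{r-1} ∈ K*`, `δ_r ∈ A` and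
`1 ≤ l ≤ r - 1`. -/
def familyV (F : Type*) {K L : Type*} [Field F] [Fintype F] [Field K] [Field L] [Algebra F K]
    [Algebra F L] [Algebra K L] [IsScalarTower F K L]
    (γ : L) (r : ℕ) (A : Finset Kˣ) : Set (Submodule F L) :=
  {W | ∃ (l : ℕ) (δ : ℕ → Kˣ), 1 ≤ l ∧ l < r ∧ δ r ∈ A ∧ W = spaceV F γ r l δ}

/-- The code: the union of the orbits of all these subspaces. -/
def unionCode (F : Type*) {K L : Type*} [Field F] [Fintype F] [Field K] [Field L] [Algebra F K]
    [Algebra F L] [Algebra K L] [IsScalarTower F K L]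
    (γ : L) (r : ℕ) (ξ : Kˣ) (A : Finset Kˣ) : Set (Submodule F L) :=
  ⋃ W ∈ familyU F γ r ξ A ∪ familyV F γ r A, cyclicOrbit W

/-! Each space consists of the values at γ of u G + u^q H for u in K, where G has constant term 1
and degree r, and H has constant term 0 and degree below r. Suppose two products of such values
agree, with parameters u, v and s, t. The difference of the polynomial products has degree at most
2r and vanishes at γ, so it is c f for a constant c. Its extreme coefficients give f(0) c = uv - st
and c = (uv - st) G_r G'_r. Since G_r and G'_r lie in A, c = 0, and the products agree as
polynomials (`IsTwistPair.twistedPoly_mul_eq`).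

Then uv = st, and the remaining terms say that either u/s lies in F_q or G H' = μ^(q-1) H G' with μ
= u/t (`IsTwistPair.proportional_of_twistedPoly_mul_eq`). The families are built so that H/G modulo
(q-1)-th powers determines every parameter: degree and lowest degree of H give p and l, the
coefficients of G give the δ's, and the θ's represent different classes modulo (q-1)-th powers
(`eq_of_relation_of_mem_codeIndices`).

Hence a d = b c with a, b in W and c, d in W' forces a/b in F_q, or W = W' and a/c in F_q. This one
property, `OrbitSeparated`, yields the Sidon property, the distance, and the size: each stabiliser
is F_q^* and orbits of different spaces are disjoint, so the size is the number of parameters times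
(q^n - 1)/(q - 1). -/

/-! ### Sidon property, distance and size from a single separation property -/

section OrbitCodes

variable {F L : Type*} [Field F] [Field L] [Algebra F L]

/-- The shifts of members of `𝒲` meet in at most a line, unless they come from the same member and
from `F`-proportional multipliers. -/
def OrbitSeparated (𝒲 : Set (Submodule F L)) : Prop :=
  ∀ W ∈ 𝒲, ∀ W' ∈ 𝒲, ∀ a ∈ W, ∀ b ∈ W, ∀ c ∈ W', ∀ d ∈ W',
    a ≠ 0 → b ≠ 0 → c ≠ 0 → d ≠ 0 → a * d = b * c →
      (∃ e : F, a = e • b) ∨ (W = W' ∧ ∃ e : F, a = e • c)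

theorem span_singleton_eq_of_eq_smul {a b : L} {e : F} (ha : a ≠ 0) (h : a = e • b) :
    Submodule.span F {a} = Submodule.span F {b} := by
  have he : e ≠ 0 := by
    rintro rfl
    exact ha (by simpa using h)
  rw [h]
  exact Submodule.span_singleton_smul_eq (IsUnit.mk0 e he) b

theorem OrbitSeparated.isSidonSpace {𝒲 : Set (Submodule F L)} (h : OrbitSeparated 𝒲)
    {W : Submodule F L} (hW : W ∈ 𝒲) : IsSidonSpace W := by
  intro a ha b hb c hc d hd ha0 hb0 hc0 hd0 habcd
  rcases h W hW W hW a ha d hd c hc b hb ha0 hd0 hc0 hb0 (by rw [habcd, mul_comm]) with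
    ⟨e, he⟩ | ⟨-, e, he⟩
  · have hcb : c = e • b := by
      apply mul_right_cancel₀ hd0
      rw [← habcd, he, Algebra.smul_def, Algebra.smul_def]
      ring
    rw [span_singleton_eq_of_eq_smul ha0 he, span_singleton_eq_of_eq_smul hc0 hcb, Set.pair_comm]
  · have hdb : d = e • b := by
      apply mul_left_cancel₀ hc0
      rw [← habcd, he, Algebra.smul_def, Algebra.smul_def]
      ring
    rw [span_singleton_eq_of_eq_smul ha0 he, span_singleton_eq_of_eq_smul hd0 hdb]

theorem Submodule.exists_not_proportional {W : Submodule F L} (hW : 2 ≤ Module.finrank F W) :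
    ∃ a ∈ W, ∃ b ∈ W, a ≠ 0 ∧ b ≠ 0 ∧ ∀ e : F, a ≠ e • b := by
  have hne : W ≠ ⊥ := by
    rintro rfl
    simp at hW
  obtain ⟨b, hb, hb0⟩ := W.exists_mem_ne_zero_of_ne_bot hne
  by_contra! hcon
  have := finrank_le_one (R := F) (⟨b, hb⟩ : W) (by
    rintro ⟨a, ha⟩
    by_cases ha0 : a = 0
    · exact ⟨0, by ext; simp [ha0]⟩
    · obtain ⟨e, he⟩ := hcon a ha b hb ha0 hb0
      exact ⟨e, by ext; simp [he]⟩)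
  omega

theorem mem_cyclicShift {α : Lˣ} {U : Submodule F L} {x : L} :
    x ∈ cyclicShift α U ↔ ∃ u ∈ U, (α : L) * u = x := by
  simp [cyclicShift]

theorem cyclicShift_mul (α β : Lˣ) (U : Submodule F L) :
    cyclicShift (α * β) U = cyclicShift α (cyclicShift β U) := by
  ext x
  simp [mem_cyclicShift, mul_assoc]

theorem cyclicShift_one (U : Submodule F L) : cyclicShift 1 U = U := by
  ext x
  simp [mem_cyclicShift]

theorem finrank_cyclicShift (α : Lˣ) (U : Submodule F L) :
    Module.finrank F (cyclicShift α U) = Module.finrank F U :=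
  (Submodule.equivMapOfInjective (LinearMap.mulLeft F (α : L))
    (fun _ _ h => mul_left_cancel₀ α.ne_zero h) U).finrank_eq.symm

theorem cyclicShift_inf (α : Lˣ) (U V : Submodule F L) :
    cyclicShift α (U ⊓ V) = cyclicShift α U ⊓ cyclicShift α V :=
  Submodule.map_inf _ fun _ _ h => mul_left_cancel₀ α.ne_zero h

theorem cyclicShift_map_algebraMap (c : Fˣ) (U : Submodule F L) :
    cyclicShift (Units.map (algebraMap F L).toMonoidHom c) U = U := by
  ext x
  rw [mem_cyclicShift]
  constructor
  · rintro ⟨u, hu, rfl⟩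
    simpa [Algebra.smul_def] using U.smul_mem (c : F) hu
  · intro hx
    refine ⟨((c⁻¹ : Fˣ) : F) • x, U.smul_mem _ hx, ?_⟩
    simp [Algebra.smul_def]

/-- Two non-proportional vectors a = αc and b = αd of the intersection satisfy a d = b c, so
separation applies and its first alternative is excluded; then α = a/c lies in F. -/
theorem OrbitSeparated.eq_of_two_le_finrank_inf {𝒲 : Set (Submodule F L)} (h : OrbitSeparated 𝒲)
    {W W' : Submodule F L} (hW : W ∈ 𝒲) (hW' : W' ∈ 𝒲) {α : Lˣ}
    (hα : 2 ≤ Module.finrank F ↥(W ⊓ cyclicShift α W')) :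
    W = W' ∧ ∃ c : Fˣ, Units.map (algebraMap F L).toMonoidHom c = α := by
  obtain ⟨a, ⟨ha, ha'⟩, b, ⟨hb, hb'⟩, ha0, hb0, hab⟩ := Submodule.exists_not_proportional hα
  obtain ⟨c, hc, rfl⟩ := mem_cyclicShift.1 ha'
  obtain ⟨d, hd, rfl⟩ := mem_cyclicShift.1 hb'
  have hc0 : c ≠ 0 := right_ne_zero_of_mul ha0
  have hd0 : d ≠ 0 := right_ne_zero_of_mul hb0
  rcases h W hW W' hW' _ ha _ hb c hc d hd ha0 hb0 hc0 hd0 (by ring) with ⟨e, he⟩ | ⟨hWW', e, he⟩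
  · exact absurd he (hab e)
  · have hαe : (α : L) = algebraMap F L e := by
      apply mul_right_cancel₀ hc0
      rw [he, Algebra.smul_def]
    have he0 : e ≠ 0 := by
      rintro rfl
      exact α.ne_zero (by simp at hαe)
    exact ⟨hWW', Units.mk0 e he0, by ext; simp [hαe]⟩

theorem OrbitSeparated.eq_of_two_le_finrank_inf_shifts {𝒲 : Set (Submodule F L)}
    (h : OrbitSeparated 𝒲) {W W' : Submodule F L} (hW : W ∈ 𝒲) (hW' : W' ∈ 𝒲) {α β : Lˣ}
    (hαβ : 2 ≤ Module.finrank F ↥(cyclicShift α W ⊓ cyclicShift β W')) :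
    W = W' ∧ ∃ c : Fˣ, Units.map (algebraMap F L).toMonoidHom c * α = β := by
  have hinf : cyclicShift α W ⊓ cyclicShift β W'
      = cyclicShift α (W ⊓ cyclicShift (α⁻¹ * β) W') := by
    rw [cyclicShift_inf, ← cyclicShift_mul, mul_inv_cancel_left]
  rw [hinf, finrank_cyclicShift] at hαβ
  obtain ⟨hWW', c, hc⟩ := h.eq_of_two_le_finrank_inf hW hW' hαβ
  exact ⟨hWW', c, by rw [hc, mul_comm, mul_inv_cancel_left]⟩

theorem OrbitSeparated.isCyclicCDC [FiniteDimensional F L] {𝒲 : Set (Submodule F L)}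
    (h : OrbitSeparated 𝒲) (hne : 𝒲.Nonempty) {k : ℕ} (hk : 2 ≤ k)
    (hdim : ∀ W ∈ 𝒲, Module.finrank F W = k) :
    IsCyclicCDC (Module.finrank F L) (2 * k - 2) k (⋃ W ∈ 𝒲, cyclicOrbit W) := by
  have hmem : ∀ U, U ∈ (⋃ W ∈ 𝒲, cyclicOrbit W) ↔ ∃ W ∈ 𝒲, ∃ α : Lˣ, U = cyclicShift α W := by
    intro U
    simp [cyclicOrbit]
  have hdim' : ∀ U ∈ (⋃ W ∈ 𝒲, cyclicOrbit W), Module.finrank F U = k := by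
    intro U hU
    obtain ⟨W, hW, α, rfl⟩ := (hmem U).1 hU
    rw [finrank_cyclicShift, hdim W hW]
  obtain ⟨W₀, hW₀⟩ := hne
  refine ⟨rfl, ⟨W₀, (hmem _).2 ⟨W₀, hW₀, 1, (cyclicShift_one _).symm⟩⟩, hdim', ⟨?_, ?_⟩, ?_⟩
  · obtain ⟨a, ha, b, hb, ha0, hb0, hab⟩ :=
      Submodule.exists_not_proportional (W := W₀) (by rw [hdim W₀ hW₀]; exact hk)
    -- The distance is attained by shifting with a/b for non-proportional a, b: both W₀ and its
    -- shift contain a, and a/b is not in F, so they meet in exactly a line.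
    set α : Lˣ := Units.mk0 a ha0 * (Units.mk0 b hb0)⁻¹ with hα
    have hαb : (α : L) * b = a := by simp [hα, hb0]
    have hlt : ¬ 2 ≤ Module.finrank F ↥(W₀ ⊓ cyclicShift α W₀) := by
      intro h2
      obtain ⟨-, c, hc⟩ := h.eq_of_two_le_finrank_inf hW₀ hW₀ h2
      apply hab c
      rw [← hαb, ← hc]
      simp [Algebra.smul_def]
    have hpos : Module.finrank F ↥(W₀ ⊓ cyclicShift α W₀) ≠ 0 := by
      intro h0
      rw [Submodule.finrank_eq_zero] at h0
      have : a ∈ W₀ ⊓ cyclicShift α W₀ := ⟨ha, mem_cyclicShift.2 ⟨b, hb, hαb⟩⟩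
      rw [h0] at this
      exact ha0 (by simpa using this)
    refine ⟨W₀, (hmem _).2 ⟨W₀, hW₀, 1, (cyclicShift_one _).symm⟩, cyclicShift α W₀,
      (hmem _).2 ⟨W₀, hW₀, α, rfl⟩, ?_, ?_⟩
    · intro heq
      rw [← heq, inf_idem, hdim W₀ hW₀] at hlt
      exact hlt hk
    · rw [subspaceDist, finrank_cyclicShift, hdim W₀ hW₀]
      omega
  · rintro m ⟨U, hU, V, hV, hUV, rfl⟩
    rw [subspaceDist, hdim' U hU, hdim' V hV]
    obtain ⟨W, hW, α, rfl⟩ := (hmem U).1 hU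
    obtain ⟨W', hW', β, rfl⟩ := (hmem V).1 hV
    have : ¬ 2 ≤ Module.finrank F ↥(cyclicShift α W ⊓ cyclicShift β W') := by
      intro h2
      obtain ⟨rfl, c, rfl⟩ := h.eq_of_two_le_finrank_inf_shifts hW hW' h2
      exact hUV (by rw [mul_comm, cyclicShift_mul, cyclicShift_map_algebraMap])
    omega
  · intro U hU β
    obtain ⟨W, hW, α, rfl⟩ := (hmem U).1 hU
    exact (hmem _).2 ⟨W, hW, β * α, (cyclicShift_mul β α W).symm⟩

/-- Writing each codeword as a chosen shift αW, the map sending (αW, c) to (W, cα) is a bijection,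
because a codeword determines W, and α up to a factor in F*. -/
theorem OrbitSeparated.ncard_mul [Finite L] {𝒲 : Set (Submodule F L)} (h : OrbitSeparated 𝒲)
    (hdim : ∀ W ∈ 𝒲, 2 ≤ Module.finrank F W) :
    (⋃ W ∈ 𝒲, cyclicOrbit W).ncard * Nat.card Fˣ = 𝒲.ncard * Nat.card Lˣ := by
  set C : Set (Submodule F L) := ⋃ W ∈ 𝒲, cyclicOrbit W with hC
  have hmem : ∀ U, U ∈ C ↔ ∃ W ∈ 𝒲, ∃ α : Lˣ, U = cyclicShift α W := by
    intro U
    simp [hC, cyclicOrbit]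
  have hch : ∀ U : C, ∃ x : 𝒲 × Lˣ, (U : Submodule F L) = cyclicShift x.2 (x.1 : Submodule F L) := by
    rintro ⟨U, hU⟩
    obtain ⟨W, hW, α, rfl⟩ := (hmem U).1 hU
    exact ⟨(⟨W, hW⟩, α), rfl⟩
  choose x hx using hch
  let φ : C × Fˣ → 𝒲 × Lˣ :=
    fun y => ((x y.1).1, Units.map (algebraMap F L).toMonoidHom y.2 * (x y.1).2)
  have hφ : ∀ y, cyclicShift (φ y).2 ((φ y).1 : Submodule F L) = y.1 := by
    intro y
    simp only [φ]
    rw [mul_comm, cyclicShift_mul, cyclicShift_map_algebraMap, ← hx]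
  have hbij : Function.Bijective φ := by
    constructor
    · intro y z hyz
      have h1 : y.1 = z.1 := Subtype.ext (by rw [← hφ y, ← hφ z, hyz])
      refine Prod.ext h1 ?_
      have h2 := congrArg Prod.snd hyz
      simp only [φ, h1] at h2
      exact Units.map_injective (f := (algebraMap F L).toMonoidHom) (algebraMap F L).injective
        (mul_right_cancel h2)
    · rintro ⟨⟨W, hW⟩, α⟩
      let U : C := ⟨cyclicShift α W, (hmem _).2 ⟨W, hW, α, rfl⟩⟩
      have hU : cyclicShift α W = cyclicShift (x U).2 ((x U).1 : Submodule F L) := hx U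
      obtain ⟨hWW, c, hc⟩ := h.eq_of_two_le_finrank_inf_shifts (α := (x U).2) (β := α)
        (x U).1.2 hW (by rw [← hU, inf_idem, finrank_cyclicShift]; exact hdim W hW)
      exact ⟨(U, c), Prod.ext (Subtype.ext hWW) hc⟩
  have := Nat.card_congr (Equiv.ofBijective φ hbij)
  rwa [Nat.card_prod, Nat.card_prod] at this

end OrbitCodes

/-! ### Products of twisted polynomials -/

section TwistedPolynomials

open Polynomial

variable {K : Type*} [Field K]

/-- The polynomial `u G + u^q H`. -/
noncomputable def twistedPoly (q : ℕ) (G H : K[X]) (u : K) : K[X] :=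
  C u * G + C (u ^ q) * H

/-- The shape of the pairs `(G, H)` whose twisted polynomials, evaluated at an element of degree
`2 r`, give the spaces of the code. -/
structure IsTwistPair (r : ℕ) (G H : K[X]) : Prop where
  natDegree_left_le : G.natDegree ≤ r
  natDegree_right_lt : H.natDegree < r
  coeff_zero_left : G.coeff 0 = 1
  coeff_zero_right : H.coeff 0 = 0
  right_ne_zero : H ≠ 0

namespace IsTwistPair

variable {r q : ℕ} {G H G' H' : K[X]}

theorem left_ne_zero (h : IsTwistPair r G H) : G ≠ 0 := by
  rintro rfl
  simpa using h.coeff_zero_left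

theorem natDegree_twistedPoly_le (h : IsTwistPair r G H) (u : K) :
    (twistedPoly q G H u).natDegree ≤ r :=
  natDegree_add_le_of_degree_le ((natDegree_C_mul_le _ _).trans h.natDegree_left_le)
    ((natDegree_C_mul_le _ _).trans h.natDegree_right_lt.le)

theorem coeff_zero_twistedPoly (h : IsTwistPair r G H) (u : K) :
    (twistedPoly q G H u).coeff 0 = u := by
  simp only [twistedPoly, coeff_add, coeff_C_mul, h.coeff_zero_left, h.coeff_zero_right]
  ring

/-- The strict bound on the degree of H keeps u^q out of the top coefficient, just as its vanishing
constant term does at the bottom. Both ends of a product are therefore multiples of uv. -/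
theorem coeff_top_twistedPoly (h : IsTwistPair r G H) (u : K) :
    (twistedPoly q G H u).coeff r = u * G.coeff r := by
  simp only [twistedPoly, coeff_add, coeff_C_mul,
    coeff_eq_zero_of_natDegree_lt h.natDegree_right_lt, mul_zero, add_zero]

/-- Degree 2r is just too large for γ to be free of relations: multiples of f by constants remain.
Comparing the lowest and highest coefficients excludes all of them but 0. -/
theorem twistedPoly_mul_eq {L : Type*} [Field L] [Algebra K L] {f : K[X]} {γ : L}
    (hirr : Irreducible f) (hmonic : f.Monic) (hdeg : f.natDegree = 2 * r) (hγ : aeval γ f = 0)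
    (h : IsTwistPair r G H) (h' : IsTwistPair r G' H')
    (hne : f.eval 0 * G.coeff r * G'.coeff r ≠ 1) {u v s t : K}
    (heq : aeval γ (twistedPoly q G H u) * aeval γ (twistedPoly q G' H' v)
      = aeval γ (twistedPoly q G H s) * aeval γ (twistedPoly q G' H' t)) :
    twistedPoly q G H u * twistedPoly q G' H' v = twistedPoly q G H s * twistedPoly q G' H' t := by
  set D := twistedPoly q G H u * twistedPoly q G' H' v
    - twistedPoly q G H s * twistedPoly q G' H' t with hD
  have hDdeg : D.natDegree ≤ 2 * r := by
    refine (natDegree_sub_le _ _).trans (max_le ?_ ?_) <;> rw [two_mul] <;>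
      exact natDegree_mul_le_of_le (h.natDegree_twistedPoly_le _) (h'.natDegree_twistedPoly_le _)
  have hdvd : f ∣ D := by
    rw [minpoly.eq_of_irreducible_of_monic hirr hγ hmonic]
    exact minpoly.dvd _ _ (by rw [hD, map_sub, map_mul, map_mul, heq, sub_self])
  obtain ⟨g, hg⟩ := hdvd
  have hgC : ∃ c, g = C c := by
    by_cases hg0 : g = 0
    · exact ⟨0, by simp [hg0]⟩
    · refine ⟨_, eq_C_of_natDegree_eq_zero ?_⟩
      rw [hg, natDegree_mul hirr.ne_zero hg0] at hDdeg
      omega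
  obtain ⟨c, rfl⟩ := hgC
  have h0 : f.eval 0 * c = u * v - s * t := by
    have := congrArg (fun p => p.coeff 0) hg
    simp only [hD, coeff_sub, mul_coeff_zero, coeff_C_zero, h.coeff_zero_twistedPoly,
      h'.coeff_zero_twistedPoly] at this
    rw [this, coeff_zero_eq_eval_zero]
  have htop : c = (u * v - s * t) * (G.coeff r * G'.coeff r) := by
    have h1 : D.coeff (r + r) = c := by
      rw [hg, coeff_mul_C, ← two_mul, ← hdeg, hmonic.coeff_natDegree, one_mul]
    rw [← h1, hD, coeff_sub, coeff_mul_add_eq_of_natDegree_le (h.natDegree_twistedPoly_le _)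
      (h'.natDegree_twistedPoly_le _), coeff_mul_add_eq_of_natDegree_le
      (h.natDegree_twistedPoly_le _) (h'.natDegree_twistedPoly_le _)]
    simp only [h.coeff_top_twistedPoly, h'.coeff_top_twistedPoly]
    ring
  have hc : c = 0 := by
    have : c * (f.eval 0 * G.coeff r * G'.coeff r - 1) = 0 := by
      rw [← h0] at htop
      linear_combination -htop
    exact (mul_eq_zero.1 this).resolve_right (sub_ne_zero.2 hne)
  rw [hc, C_0, mul_zero] at hg
  exact sub_eq_zero.1 hg

theorem eq_zero_of_aeval_eq_zero {L : Type*} [Field L] [Algebra K L] {f : K[X]} {γ : L}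
    (hr : 0 < r) (hirr : Irreducible f) (hmonic : f.Monic) (hdeg : f.natDegree = 2 * r)
    (hγ : aeval γ f = 0) (h : IsTwistPair r G H) {u : K}
    (hu : aeval γ (twistedPoly q G H u) = 0) : u = 0 := by
  have hdvd : f ∣ twistedPoly q G H u := by
    rw [minpoly.eq_of_irreducible_of_monic hirr hγ hmonic]
    exact minpoly.dvd _ _ hu
  have h0 : twistedPoly q G H u = 0 := by
    by_contra hne
    have := natDegree_le_of_dvd hdvd hne
    have := h.natDegree_twistedPoly_le (q := q) u
    omega
  rw [← h.coeff_zero_twistedPoly (q := q) u, h0, coeff_zero]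

/-- Constant terms give uv = st, which cancels the G G' and H H' terms. The two mixed terms remain,
and the quotient of their coefficients is a (q-1)-th power. -/
theorem proportional_of_twistedPoly_mul_eq (h : IsTwistPair r G H) (h' : IsTwistPair r G' H')
    (hq : 1 ≤ q) {u v s t : K} (hs : s ≠ 0) (ht : t ≠ 0)
    (heq : twistedPoly q G H u * twistedPoly q G' H' v
      = twistedPoly q G H s * twistedPoly q G' H' t) :
    (u / s) ^ q = u / s ∨ G * H' = C ((u / t) ^ (q - 1)) * (H * G') := by
  obtain ⟨m, rfl⟩ : ∃ m, q = m + 1 := ⟨q - 1, by omega⟩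
  have huv : u * v = s * t := by
    have := congrArg (fun p => p.coeff 0) heq
    simpa only [mul_coeff_zero, h.coeff_zero_twistedPoly, h'.coeff_zero_twistedPoly] using this
  have hpow : u ^ m * v ^ m = s ^ m * t ^ m := by
    rw [← mul_pow, huv, mul_pow]
  have huv' : u ^ (m + 1) * v ^ (m + 1) = s ^ (m + 1) * t ^ (m + 1) := by
    rw [← mul_pow, huv, mul_pow]
  by_cases hus : (u / s) ^ (m + 1) = u / s
  · exact Or.inl hus
  right
  -- If the coefficient of G H' vanished, uv = st would give t^(q-1) = v^(q-1), hence u^(q-1) =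
  -- s^(q-1), so that u/s would be fixed by the q-th power map.
  have hus' : s * t ^ (m + 1) - u * v ^ (m + 1) ≠ 0 := by
    intro h0
    apply hus
    have h1 : s * t * (t ^ m - v ^ m) = 0 := by
      linear_combination h0 + v ^ m * huv
    have h2 : t ^ m - v ^ m = 0 := (mul_eq_zero.1 h1).resolve_left (mul_ne_zero hs ht)
    have h3 : u ^ m = s ^ m := by
      apply mul_right_cancel₀ (pow_ne_zero m ht)
      linear_combination hpow + u ^ m * h2
    rw [pow_succ, div_pow, h3, div_self (pow_ne_zero m hs), one_mul]
  have hrel : C (s * t ^ (m + 1) - u * v ^ (m + 1)) * (G * H')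
      = C (u ^ (m + 1) * v - s ^ (m + 1) * t) * (H * G') := by
    have e1 : (C u : K[X]) * C v = C s * C t := by rw [← C_mul, huv, C_mul]
    have e2 : (C (u ^ (m + 1)) : K[X]) * C (v ^ (m + 1)) = C (s ^ (m + 1)) * C (t ^ (m + 1)) := by
      rw [← C_mul, huv', C_mul]
    simp only [twistedPoly] at heq
    simp only [C_sub, C_mul]
    linear_combination (-1 : K[X]) * heq + G * G' * e1 + H * H' * e2
  have hcoef : u ^ (m + 1) * v - s ^ (m + 1) * t
      = (s * t ^ (m + 1) - u * v ^ (m + 1)) * (u / t) ^ (m + 1 - 1) := by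
    rw [Nat.add_sub_cancel, div_pow, ← mul_div_assoc, eq_div_iff (pow_ne_zero m ht)]
    linear_combination (u ^ m * t ^ m + s ^ m * t ^ m) * huv + u * v * hpow
  rw [hcoef, C_mul, mul_assoc] at hrel
  exact mul_left_cancel₀ (C_ne_zero.2 hus') hrel

end IsTwistPair

/-- After cancelling X^l, the constant terms match the scalars. -/
theorem left_eq_and_eq_mul_of_monomials {G G' : K[X]} (hG : G.coeff 0 = 1) (hG' : G'.coeff 0 = 1)
    {a a' c : K} (ha' : a' ≠ 0) {l : ℕ}
    (h : G * (C a' * X ^ l) = C c * ((C a * X ^ l) * G')) : G = G' ∧ a' = c * a := by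
  have h1 : C a' * G = C (c * a) * G' := by
    apply mul_right_cancel₀ (pow_ne_zero l (X_ne_zero (R := K)))
    rw [C_mul]
    linear_combination h
  have h2 : a' = c * a := by
    have := congrArg (fun p => p.coeff 0) h1
    simpa [hG, hG'] using this
  refine ⟨?_, h2⟩
  rw [← h2] at h1
  exact mul_left_cancel₀ (C_ne_zero.2 ha') h1

/-- If the part of `G` supported on the multiples of `l` is `1 + h(X^l)`, the pair
`(G, θ h(X^l))` is determined up to an obvious scaling by the quotient of its entries. -/
theorem left_eq_and_eq_mul_of_contract {l : ℕ} (hl : l ≠ 0) {G G' h h' : K[X]} {θ θ' c : K}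
    (hG : contract l G = 1 + h) (hG' : contract l G' = 1 + h')
    (hdeg : h.natDegree = h'.natDegree) (hpos : 0 < h.natDegree) (hθ' : θ' ≠ 0)
    (heq : G * (C θ' * expand K l h') = C c * ((C θ * expand K l h) * G')) :
    G = G' ∧ θ' = c * θ := by
  have hh : h ≠ 0 := by
    rintro rfl
    simp at hpos
  have hh' : h' ≠ 0 := by
    rintro rfl
    rw [hdeg] at hpos
    simp at hpos
  have e1 : G * expand K l (C θ' * h') = G' * expand K l (C (c * θ) * h) := by
    simp only [map_mul, expand_C]
    linear_combination heq
  -- Keeping only the exponents divisible by l turns the relation into one between h and h' alone.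
  have e2 : (1 + h) * (C θ' * h') = (1 + h') * (C (c * θ) * h) := by
    rw [← hG, ← hG', ← contract_mul_expand hl, ← contract_mul_expand hl, e1]
  have e3 : C (θ' - c * θ) * (h * h') = C (c * θ) * h - C θ' * h' := by
    rw [C_sub]
    linear_combination e2
  -- Otherwise the left side of `e3` has twice the degree of h, while the right side has at most the
  -- degree of h, which is positive.
  have hc : θ' = c * θ := by
    by_contra hne
    have h1 : (C (θ' - c * θ) * (h * h')).natDegree = h.natDegree + h.natDegree := by
      rw [natDegree_C_mul (sub_ne_zero.2 hne), natDegree_mul hh hh', ← hdeg]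
    have h2 : (C (c * θ) * h - C θ' * h').natDegree ≤ h.natDegree :=
      (natDegree_sub_le _ _).trans (max_le (natDegree_C_mul_le _ _)
        ((natDegree_C_mul_le _ _).trans hdeg.ge))
    rw [e3] at h1
    omega
  refine ⟨?_, hc⟩
  rw [← hc, sub_self, C_0, zero_mul] at e3
  have hhh : h = h' := mul_left_cancel₀ (C_ne_zero.2 hθ') (sub_eq_zero.1 e3.symm)
  rw [← hhh, ← hc] at e1
  refine mul_right_cancel₀ ?_ e1
  simp [hh, hθ', expand_eq_zero (Nat.pos_of_ne_zero hl)]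

end TwistedPolynomials

/-! ### Evaluation at γ: dimension and separation -/

section TwistedSpaces

open Polynomial

variable {F K L : Type*} [Field F] [Fintype F] [Field K] [Field L] [Algebra F K] [Algebra F L]
  [Algebra K L] [IsScalarTower F K L]

/-- The polynomial X^q - X has at most q roots, and the image of F already supplies q of them. -/
theorem exists_algebraMap_eq_of_pow_card_eq {x : K} (hx : x ^ Fintype.card F = x) :
    ∃ e : F, algebraMap F K e = x := by
  classical
  have hP := FiniteField.X_pow_card_sub_X_ne_zero K (Fintype.one_lt_card (α := F))
  have hsub : (Finset.univ.image (algebraMap F K)) ⊆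
      (X ^ Fintype.card F - X : K[X]).roots.toFinset := by
    intro y hy
    obtain ⟨e, -, rfl⟩ := Finset.mem_image.1 hy
    simp only [Multiset.mem_toFinset, mem_roots hP, IsRoot.def, eval_sub, eval_pow, eval_X]
    rw [← map_pow, FiniteField.pow_card, sub_self]
  have hcard : (X ^ Fintype.card F - X : K[X]).roots.toFinset.card
      ≤ (Finset.univ.image (algebraMap F K)).card := by
    rw [Finset.card_image_of_injective _ (algebraMap F K).injective, Finset.card_univ]
    refine (Multiset.toFinset_card_le _).trans ((card_roots' _).trans ?_)
    rw [FiniteField.X_pow_card_sub_X_natDegree_eq K (Fintype.one_lt_card (α := F))]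
  have hmem : x ∈ Finset.univ.image (algebraMap F K) := by
    rw [Finset.eq_of_subset_of_card_le hsub hcard]
    simp [mem_roots hP, hx]
  obtain ⟨e, -, he⟩ := Finset.mem_image.1 hmem
  exact ⟨e, he⟩

theorem aeval_twistedPoly_smul (γ : L) (G H : K[X]) (e : F) (u : K) :
    aeval γ (twistedPoly (Fintype.card F) G H (e • u))
      = e • aeval γ (twistedPoly (Fintype.card F) G H u) := by
  rw [twistedPoly, twistedPoly, smul_pow_card_of_algebra]
  simp only [map_add, map_mul, aeval_C, Algebra.smul_def, IsScalarTower.algebraMap_apply F K L]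
  ring

theorem finrank_eq_of_twistedPoly [FiniteDimensional F K] [FiniteDimensional F L] {r : ℕ}
    {f : K[X]} {γ : L} (hr : 0 < r)
    (hirr : Irreducible f) (hmonic : f.Monic) (hdeg : f.natDegree = 2 * r) (hγ : aeval γ f = 0)
    {G H : K[X]} (h : IsTwistPair r G H) {W : Submodule F L}
    (hW : ∀ x, x ∈ W ↔ ∃ u : K, x = aeval γ (twistedPoly (Fintype.card F) G H u)) :
    Module.finrank F W = Module.finrank F K := by
  let φ : K →ₗ[F] W :=
    { toFun := fun u => ⟨aeval γ (twistedPoly (Fintype.card F) G H u), (hW _).2 ⟨u, rfl⟩⟩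
      map_add' := by
        intro u v
        ext
        simp only [twistedPoly, add_pow_card_of_algebra (F := F), map_add, map_mul,
          Submodule.coe_add]
        ring
      map_smul' := by
        intro e u
        ext
        simp [aeval_twistedPoly_smul] }
  refine (LinearEquiv.ofBijective φ ⟨?_, ?_⟩).finrank_eq.symm
  · rw [← LinearMap.ker_eq_bot, LinearMap.ker_eq_bot']
    intro u hu
    exact h.eq_zero_of_aeval_eq_zero hr hirr hmonic hdeg hγ (congrArg Subtype.val hu)
  · rintro ⟨x, hx⟩
    obtain ⟨u, hu⟩ := (hW x).1 hx
    exact ⟨u, Subtype.ext hu.symm⟩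

theorem orbitSeparated_image {ι : Type*} {J : Set ι} {r : ℕ} {f : K[X]} {γ : L}
    (hirr : Irreducible f) (hmonic : f.Monic) (hdeg : f.natDegree = 2 * r) (hγ : aeval γ f = 0)
    {G H : ι → K[X]} (h : ∀ i ∈ J, IsTwistPair r (G i) (H i))
    (hne : ∀ i ∈ J, ∀ j ∈ J, f.eval 0 * (G i).coeff r * (G j).coeff r ≠ 1)
    (hrel : ∀ i ∈ J, ∀ j ∈ J, ∀ μ : Kˣ,
      G i * H j = C ((μ : K) ^ (Fintype.card F - 1)) * (H i * G j) → i = j)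
    {W : ι → Submodule F L}
    (hW : ∀ i ∈ J, ∀ x, x ∈ W i ↔
      ∃ u : K, x = aeval γ (twistedPoly (Fintype.card F) (G i) (H i) u))
    {i j : ι} (hi : i ∈ J) (hj : j ∈ J) {a b c d : L} (ha : a ∈ W i) (hb : b ∈ W i)
    (hc : c ∈ W j) (hd : d ∈ W j) (ha0 : a ≠ 0) (hb0 : b ≠ 0) (hc0 : c ≠ 0)
    (habcd : a * d = b * c) :
    (∃ e : F, a = e • b) ∨ (i = j ∧ ∃ e : F, a = e • c) := by
  have hzero : ∀ i : ι, aeval γ (twistedPoly (Fintype.card F) (G i) (H i) (0 : K)) = 0 := by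
    intro i
    simp [twistedPoly, Fintype.card_ne_zero]
  have hq : 1 < Fintype.card F := Fintype.one_lt_card
  have hq1 : Fintype.card F - 1 + 1 = Fintype.card F := by omega
  obtain ⟨u, rfl⟩ := (hW i hi a).1 ha
  obtain ⟨s, rfl⟩ := (hW i hi b).1 hb
  obtain ⟨t, rfl⟩ := (hW j hj c).1 hc
  obtain ⟨v, rfl⟩ := (hW j hj d).1 hd
  have hu : u ≠ 0 := fun h0 => ha0 (by rw [h0, hzero])
  have hs : s ≠ 0 := fun h0 => hb0 (by rw [h0, hzero])
  have ht : t ≠ 0 := fun h0 => hc0 (by rw [h0, hzero])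
  have hscalar : ∀ x y : K, y ≠ 0 → (x / y) ^ Fintype.card F = x / y → ∃ e : F, x = e • y := by
    intro x y hy hxy
    obtain ⟨e, he⟩ := exists_algebraMap_eq_of_pow_card_eq hxy
    refine ⟨e, ?_⟩
    rw [Algebra.smul_def, he]
    field_simp
  have hpoly := (h i hi).twistedPoly_mul_eq hirr hmonic hdeg hγ (h j hj) (hne i hi j hj) habcd
  rcases (h i hi).proportional_of_twistedPoly_mul_eq (h j hj) hq.le hs ht hpoly with hus | hGH
  · obtain ⟨e, rfl⟩ := hscalar u s hs hus
    exact Or.inl ⟨e, aeval_twistedPoly_smul _ _ _ _ _⟩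
  · right
    obtain rfl := hrel i hi j hj (Units.mk0 (u / t) (div_ne_zero hu ht)) hGH
    refine ⟨rfl, ?_⟩
    -- Now both pairs coincide, so the nonzero product G H cancels from the relation.
    have hone : (u / t) ^ (Fintype.card F - 1) = 1 := by
      have hnz := mul_ne_zero (h i hi).left_ne_zero (h i hi).right_ne_zero
      rw [mul_comm (H i)] at hGH
      have := mul_right_cancel₀ hnz ((one_mul _).trans hGH)
      exact C_injective (by rw [← this, C_1])
    obtain ⟨e, rfl⟩ := hscalar u t ht (by rw [← hq1, pow_succ, hone, one_mul])
    exact ⟨e, aeval_twistedPoly_smul _ _ _ _ _⟩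

end TwistedSpaces

/-! ### Recovering the parameters from the quotient H/G -/

section Generators

open Polynomial

variable {K : Type*} [Field K]

/-- The polynomial `1 + ∑_{b ∈ S} δ_b X^b`. -/
noncomputable def onePlusSum (S : Finset ℕ) (δ : ℕ → Kˣ) : K[X] :=
  1 + ∑ b ∈ S, C (δ b : K) * X ^ b

/-- The polynomial `∑_{a = 1}^p δ_{a l} X^a`. -/
noncomputable def progressionSum (p l : ℕ) (δ : ℕ → Kˣ) : K[X] :=
  ∑ a ∈ Finset.Icc 1 p, C (δ (a * l) : K) * X ^ a

theorem coeff_onePlusSum (S : Finset ℕ) (δ : ℕ → Kˣ) (n : ℕ) :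
    (onePlusSum S δ).coeff n = (if n = 0 then 1 else 0) + if n ∈ S then (δ n : K) else 0 := by
  simp [onePlusSum, coeff_one, coeff_X_pow]

theorem coeff_progressionSum (p l : ℕ) (δ : ℕ → Kˣ) (n : ℕ) :
    (progressionSum p l δ).coeff n = if 1 ≤ n ∧ n ≤ p then (δ (n * l) : K) else 0 := by
  simp [progressionSum, coeff_X_pow]

theorem coeff_zero_onePlusSum {S : Finset ℕ} (hS : 0 ∉ S) (δ : ℕ → Kˣ) :
    (onePlusSum S δ).coeff 0 = 1 := by
  simp [coeff_onePlusSum, hS]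

theorem coeff_onePlusSum_of_mem {S : Finset ℕ} (hS : 0 ∉ S) (δ : ℕ → Kˣ) {n : ℕ} (hn : n ∈ S) :
    (onePlusSum S δ).coeff n = δ n := by
  have : n ≠ 0 := fun h => hS (h ▸ hn)
  simp [coeff_onePlusSum, hn, this]

theorem natDegree_onePlusSum {r : ℕ} {S : Finset ℕ} (hS : S ⊆ Finset.Icc 1 r) (hr : r ∈ S)
    (δ : ℕ → Kˣ) : (onePlusSum S δ).natDegree = r := by
  have h0 : 0 ∉ S := fun h => by simpa using hS h
  refine natDegree_eq_of_le_of_coeff_ne_zero ?_ ?_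
  · rw [natDegree_le_iff_coeff_eq_zero]
    intro n hn
    have h1 : n ∉ S := fun h => by
      have := Finset.mem_Icc.1 (hS h)
      omega
    have h2 : n ≠ 0 := by omega
    simp [coeff_onePlusSum, h1, h2]
  · rw [coeff_onePlusSum_of_mem h0 δ hr]
    exact (δ r).ne_zero

theorem natDegree_progressionSum {p : ℕ} (hp : 1 ≤ p) (l : ℕ) (δ : ℕ → Kˣ) :
    (progressionSum p l δ).natDegree = p := by
  refine natDegree_eq_of_le_of_coeff_ne_zero ?_ ?_
  · rw [natDegree_le_iff_coeff_eq_zero]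
    intro n hn
    rw [coeff_progressionSum, if_neg (by omega)]
  · rw [coeff_progressionSum, if_pos ⟨hp, le_rfl⟩]
    exact (δ (p * l)).ne_zero

theorem progressionSum_ne_zero {p : ℕ} (hp : 1 ≤ p) (l : ℕ) (δ : ℕ → Kˣ) :
    progressionSum p l δ ≠ 0 := by
  intro h
  have := natDegree_progressionSum hp l δ
  rw [h, natDegree_zero] at this
  omega

/-- The two bounds say that l, 2l, …, pl are all the multiples of l in [1, r]. This is where r/(p+1)
< l < r/p is needed. -/
theorem contract_onePlusSum_eq {r p l : ℕ} (hl : 1 ≤ l) (hpl : p * l < r) (hrl : r < (p + 1) * l)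
    (δ : ℕ → Kˣ) :
    contract l (onePlusSum (Finset.Icc 1 r) δ) = 1 + progressionSum p l δ := by
  have hl0 : l ≠ 0 := by omega
  ext n
  rw [coeff_contract hl0, coeff_add, coeff_onePlusSum, coeff_progressionSum, coeff_one]
  have h2 : n * l ∈ Finset.Icc 1 r ↔ 1 ≤ n ∧ n ≤ p := by
    rw [Finset.mem_Icc]
    constructor
    · rintro ⟨h, h'⟩
      refine ⟨Nat.pos_of_ne_zero (by rintro rfl; omega), ?_⟩
      have : n * l < (p + 1) * l := by omega
      have := lt_of_mul_lt_mul_right this (Nat.zero_le l)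
      omega
    · rintro ⟨h, h'⟩
      have h3 : n * l ≤ p * l := Nat.mul_le_mul_right l h'
      have h4 : 1 * 1 ≤ n * l := Nat.mul_le_mul h hl
      omega
  simp [h2, hl0]

theorem natTrailingDegree_expand_progressionSum {p l : ℕ} (hp : 1 ≤ p) (hl : 1 ≤ l) {θ : K}
    (hθ : θ ≠ 0) (δ : ℕ → Kˣ) :
    (C θ * expand K l (progressionSum p l δ)).natTrailingDegree = l := by
  have hcoeff : ∀ n, (C θ * expand K l (progressionSum p l δ)).coeff n
      = θ * if l ∣ n then (progressionSum p l δ).coeff (n / l) else 0 := by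
    intro n
    rw [coeff_C_mul, coeff_expand hl]
  refine le_antisymm (natTrailingDegree_le_of_ne_zero ?_) (le_natTrailingDegree ?_ ?_)
  · rw [hcoeff, if_pos dvd_rfl, Nat.div_self hl, coeff_progressionSum, if_pos ⟨le_rfl, hp⟩]
    exact mul_ne_zero hθ (δ _).ne_zero
  · exact mul_ne_zero (C_ne_zero.2 hθ) ((expand_ne_zero hl).2 (progressionSum_ne_zero hp l δ))
  · intro m hm
    rw [hcoeff, Nat.div_eq_of_lt hm, coeff_progressionSum]
    simp

theorem natDegree_expand_progressionSum {p : ℕ} (hp : 1 ≤ p) (l : ℕ) {θ : K}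
    (hθ : θ ≠ 0) (δ : ℕ → Kˣ) :
    (C θ * expand K l (progressionSum p l δ)).natDegree = p * l := by
  rw [natDegree_C_mul hθ, natDegree_expand, natDegree_progressionSum hp]

theorem expand_progressionSum_one (l : ℕ) (θ : K) (δ : ℕ → Kˣ) :
    C θ * expand K l (progressionSum 1 l δ) = C (θ * δ l) * X ^ l := by
  simp [progressionSum, mul_assoc]

/-- Degree and lowest degree are additive; G and G' contribute the same degree to both sides, and
lowest degree 0. -/
theorem degrees_eq_of_mul_eq {G H G' H' : K[X]} {c : K} (hc : c ≠ 0) (hH : H ≠ 0) (hH' : H' ≠ 0)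
    (hG : G.coeff 0 = 1) (hG' : G'.coeff 0 = 1) (hdeg : G.natDegree = G'.natDegree)
    (h : G * H' = C c * (H * G')) :
    H'.natDegree = H.natDegree ∧ H'.natTrailingDegree = H.natTrailingDegree := by
  have hne : ∀ {P : K[X]}, P.coeff 0 = 1 → P ≠ 0 ∧ P.natTrailingDegree = 0 := by
    intro P hP
    have h0 : P.coeff 0 ≠ 0 := by
      rw [hP]
      exact one_ne_zero
    exact ⟨fun h => h0 (by simp [h]), Nat.le_zero.1 (natTrailingDegree_le_of_ne_zero h0)⟩
  obtain ⟨h1, h2⟩ := hne hG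
  obtain ⟨h3, h4⟩ := hne hG'
  have hCc : C c ≠ 0 := C_ne_zero.2 hc
  constructor
  · have := congrArg natDegree h
    rw [natDegree_mul h1 hH', natDegree_C_mul hc, natDegree_mul hH h3] at this
    omega
  · have := congrArg natTrailingDegree h
    rw [natTrailingDegree_mul h1 hH', natTrailingDegree_mul hCc (mul_ne_zero hH h3),
      natTrailingDegree_mul hH h3, natTrailingDegree_C] at this
    omega

theorem onePlusSum_congr {S : Finset ℕ} {δ δ' : ℕ → Kˣ} (h : ∀ n ∈ S, δ n = δ' n) :
    onePlusSum S δ = onePlusSum S δ' := by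
  rw [onePlusSum, onePlusSum, Finset.sum_congr rfl fun n hn => by rw [h n hn]]

theorem eqOn_of_onePlusSum_eq {S : Finset ℕ} (hS : 0 ∉ S) {δ δ' : ℕ → Kˣ}
    (h : onePlusSum S δ = onePlusSum S δ') : ∀ n ∈ S, δ n = δ' n := by
  intro n hn
  apply Units.ext
  rw [← coeff_onePlusSum_of_mem hS δ hn, h, coeff_onePlusSum_of_mem hS δ' hn]

theorem isTwistPair_onePlusSum_progressionSum {r p l : ℕ} (hr : 1 ≤ r) (hp : 1 ≤ p) (hl : 1 ≤ l)
    (hpl : p * l < r) {θ : K} (hθ : θ ≠ 0) (δ : ℕ → Kˣ) :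
    IsTwistPair r (onePlusSum (Finset.Icc 1 r) δ) (C θ * expand K l (progressionSum p l δ)) where
  natDegree_left_le := (natDegree_onePlusSum subset_rfl (by simp [hr]) δ).le
  natDegree_right_lt := by rwa [natDegree_expand_progressionSum hp l hθ]
  coeff_zero_left := coeff_zero_onePlusSum (by simp) δ
  coeff_zero_right := coeff_eq_zero_of_lt_natTrailingDegree
    (by rw [natTrailingDegree_expand_progressionSum hp hl hθ]; omega)
  right_ne_zero := mul_ne_zero (C_ne_zero.2 hθ)
    ((expand_ne_zero hl).2 (progressionSum_ne_zero hp l δ))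

theorem isTwistPair_onePlusSum_X_pow {r l : ℕ} (hl : 1 ≤ l) (hlr : l < r) (δ : ℕ → Kˣ) :
    IsTwistPair r (onePlusSum (Finset.Icc 1 r \ {l}) δ) (X ^ l) where
  natDegree_left_le := by
    rw [natDegree_onePlusSum Finset.sdiff_subset _ δ]
    simp only [Finset.mem_sdiff, Finset.mem_Icc, Finset.mem_singleton]
    omega
  natDegree_right_lt := by rwa [natDegree_X_pow]
  coeff_zero_left := coeff_zero_onePlusSum (by simp) δ
  coeff_zero_right := by simp; omega
  right_ne_zero := pow_ne_zero _ X_ne_zero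

/-- The pairs `(p, l)` that the Sidon spaces `U` use, with `r / (p + 1) < l < r / p` cleared of
denominators. -/
def IsStepPair (r p l : ℕ) : Prop :=
  1 ≤ p ∧ 1 ≤ l ∧ p * l < r ∧ (p ≠ 1 → r < (p + 1) * l)

theorem eq_of_relation_progression {r p l p' l' : ℕ} (hpl : IsStepPair r p l)
    (hpl' : IsStepPair r p' l') {θ θ' c : K} (hθ : θ ≠ 0) (hθ' : θ' ≠ 0) (hc : c ≠ 0)
    {δ δ' : ℕ → Kˣ}
    (h : onePlusSum (Finset.Icc 1 r) δ * (C θ' * expand K l' (progressionSum p' l' δ'))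
      = C c * ((C θ * expand K l (progressionSum p l δ)) * onePlusSum (Finset.Icc 1 r) δ')) :
    p = p' ∧ l = l' ∧ θ' = c * θ ∧ ∀ n ∈ Finset.Icc 1 r, δ n = δ' n := by
  obtain ⟨hp1, hl1, hplr, hrpl⟩ := hpl
  obtain ⟨hp1', hl1', hplr', hrpl'⟩ := hpl'
  have hl0 : l ≠ 0 := by omega
  have hr : 1 ≤ r := by omega
  have h0 : 0 ∉ Finset.Icc 1 r := by simp
  have T := isTwistPair_onePlusSum_progressionSum hr hp1 hl1 hplr hθ δ
  have T' := isTwistPair_onePlusSum_progressionSum hr hp1' hl1' hplr' hθ' δ'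
  obtain ⟨hd, ht⟩ := degrees_eq_of_mul_eq hc T.right_ne_zero T'.right_ne_zero T.coeff_zero_left
    T'.coeff_zero_left (by rw [natDegree_onePlusSum subset_rfl (by simp [hr]),
      natDegree_onePlusSum subset_rfl (by simp [hr])]) h
  rw [natDegree_expand_progressionSum hp1 l hθ, natDegree_expand_progressionSum hp1' l' hθ'] at hd
  rw [natTrailingDegree_expand_progressionSum hp1 hl1 hθ,
    natTrailingDegree_expand_progressionSum hp1' hl1' hθ'] at ht
  subst ht
  obtain rfl := Nat.eq_of_mul_eq_mul_right hl1 hd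
  -- For p = 1 further multiples of l may be at most r, so contraction need not give 1 + h; but H is
  -- then a monomial and can be cancelled directly.
  by_cases hpone : p' = 1
  · subst hpone
    rw [expand_progressionSum_one, expand_progressionSum_one] at h
    obtain ⟨hGG, hθθ⟩ := left_eq_and_eq_mul_of_monomials T.coeff_zero_left T'.coeff_zero_left
      (mul_ne_zero hθ' (δ' _).ne_zero) h
    have hδ := eqOn_of_onePlusSum_eq h0 hGG
    refine ⟨rfl, rfl, ?_, hδ⟩
    rw [hδ l' (by simp; omega), ← mul_assoc] at hθθ
    exact mul_right_cancel₀ (δ' l').ne_zero hθθ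
  · obtain ⟨hGG, hθθ⟩ := left_eq_and_eq_mul_of_contract hl0
      (contract_onePlusSum_eq hl1 hplr (hrpl hpone) δ)
      (contract_onePlusSum_eq hl1 hplr (hrpl hpone) δ')
      (by rw [natDegree_progressionSum hp1, natDegree_progressionSum hp1])
      (by rw [natDegree_progressionSum hp1]; omega) hθ' h
    exact ⟨rfl, rfl, hθθ, eqOn_of_onePlusSum_eq h0 hGG⟩

/-- Degrees force p = 1 and equal l, and cancelling X^l gives G = G'. But the coefficient at l is a
unit for the U-type pair and 0 for the V-type pair. -/
theorem false_of_relation_progression_X_pow {r p l l' : ℕ} (hpl : IsStepPair r p l)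
    (hl1' : 1 ≤ l') (hlr' : l' < r) {θ c : K} (hθ : θ ≠ 0) (hc : c ≠ 0)
    {δ δ' : ℕ → Kˣ}
    (h : onePlusSum (Finset.Icc 1 r) δ * X ^ l'
      = C c * ((C θ * expand K l (progressionSum p l δ))
        * onePlusSum (Finset.Icc 1 r \ {l'}) δ')) : False := by
  obtain ⟨hp1, hl1, hplr, hrpl⟩ := hpl
  have hr : 1 ≤ r := by omega
  have T := isTwistPair_onePlusSum_progressionSum hr hp1 hl1 hplr hθ δ
  have T' := isTwistPair_onePlusSum_X_pow hl1' hlr' δ'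
  obtain ⟨hd, ht⟩ := degrees_eq_of_mul_eq hc T.right_ne_zero T'.right_ne_zero T.coeff_zero_left
    T'.coeff_zero_left (by
      rw [natDegree_onePlusSum subset_rfl (by simp [hr]),
        natDegree_onePlusSum Finset.sdiff_subset (by simp; omega)]) h
  rw [natDegree_expand_progressionSum hp1 l hθ, natDegree_X_pow] at hd
  rw [natTrailingDegree_expand_progressionSum hp1 hl1 hθ, natTrailingDegree_X_pow] at ht
  subst ht
  obtain rfl : p = 1 := by
    apply Nat.eq_of_mul_eq_mul_right hl1
    omega
  have hX : (X : K[X]) ^ l' = C 1 * X ^ l' := by rw [C_1, one_mul]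
  rw [expand_progressionSum_one] at h
  replace h := (congrArg (onePlusSum (Finset.Icc 1 r) δ * ·) hX).symm.trans h
  have hGG := (left_eq_and_eq_mul_of_monomials (a := θ * δ l') T.coeff_zero_left
    T'.coeff_zero_left one_ne_zero h).1
  have hco : (onePlusSum (Finset.Icc 1 r) δ).coeff l'
      = (onePlusSum (Finset.Icc 1 r \ {l'}) δ').coeff l' := by rw [hGG]
  rw [coeff_onePlusSum_of_mem (by simp) δ (Finset.mem_Icc.2 ⟨hl1', hlr'.le⟩), coeff_onePlusSum,
    if_neg (by omega), if_neg (by simp), add_zero] at hco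
  exact (δ l').ne_zero hco

theorem eq_of_relation_X_pow {r l l' : ℕ} (hl1 : 1 ≤ l) (hlr : l < r)
    (hl1' : 1 ≤ l') (hlr' : l' < r) {c : K} (hc : c ≠ 0) {δ δ' : ℕ → Kˣ}
    (h : onePlusSum (Finset.Icc 1 r \ {l}) δ * X ^ l'
      = C c * (X ^ l * onePlusSum (Finset.Icc 1 r \ {l'}) δ')) :
    l = l' ∧ ∀ n ∈ Finset.Icc 1 r \ {l}, δ n = δ' n := by
  have T := isTwistPair_onePlusSum_X_pow hl1 hlr δ
  have T' := isTwistPair_onePlusSum_X_pow hl1' hlr' δ'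
  obtain ⟨-, ht⟩ := degrees_eq_of_mul_eq hc T.right_ne_zero T'.right_ne_zero T.coeff_zero_left
    T'.coeff_zero_left (by
      rw [natDegree_onePlusSum Finset.sdiff_subset (by simp; omega),
        natDegree_onePlusSum Finset.sdiff_subset (by simp; omega)]) h
  rw [natTrailingDegree_X_pow, natTrailingDegree_X_pow] at ht
  subst ht
  rw [← one_mul (X ^ l'), ← C_1] at h
  have hGG := (left_eq_and_eq_mul_of_monomials T.coeff_zero_left T'.coeff_zero_left
    one_ne_zero h).1
  exact ⟨rfl, eqOn_of_onePlusSum_eq (by simp) hGG⟩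

end Generators

/-! ### The spaces as values of twisted polynomials -/

section Spaces

open Polynomial

variable {F K L : Type*} [Fintype F] [Field K] [Field L] [Algebra K L]

/-- The summand u of θu^q + u completes G to a sum over all of [1, r]; the summand θu^q makes up H.
-/
theorem elemU_eq_aeval (γ : L) {r p l : ℕ} (hl : 1 ≤ l) (hpl : p * l ≤ r) (θ : K) (δ : ℕ → Kˣ)
    (u : K) :
    elemU (F := F) γ r p l θ δ u = aeval γ (twistedPoly (Fintype.card F)
      (onePlusSum (Finset.Icc 1 r) δ) (C θ * expand K l (progressionSum p l δ)) u) := by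
  have hsub : (Finset.Icc 1 p).image (fun a => a * l) ⊆ Finset.Icc 1 r := by
    intro b hb
    obtain ⟨a, ha, rfl⟩ := Finset.mem_image.1 hb
    obtain ⟨ha1, hap⟩ := Finset.mem_Icc.1 ha
    have h3 : a * l ≤ p * l := Nat.mul_le_mul_right l hap
    have h4 : 1 * 1 ≤ a * l := Nat.mul_le_mul ha1 hl
    exact Finset.mem_Icc.2 (by omega)
  have hsplit : ∑ b ∈ Finset.Icc 1 r, algebraMap K L (δ b) * γ ^ b
      = ∑ b ∈ Finset.Icc 1 r \ (Finset.Icc 1 p).image (fun a => a * l),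
          algebraMap K L (δ b) * γ ^ b
        + ∑ a ∈ Finset.Icc 1 p, algebraMap K L (δ (a * l)) * γ ^ (a * l) := by
    rw [← Finset.sum_sdiff hsub, Finset.sum_image]
    intro a _ b _ hab
    exact Nat.eq_of_mul_eq_mul_right hl hab
  simp only [elemU, twistedPoly, onePlusSum, progressionSum, map_add, map_mul, map_one, map_sum,
    aeval_C, aeval_X, map_pow, expand_C, expand_X, ← pow_mul, mul_comm l]
  rw [hsplit]
  simp only [mul_add, add_mul, Finset.sum_add_distrib, Finset.mul_sum, mul_one, mul_assoc,
    mul_left_comm]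
  ring

theorem elemV_eq_aeval (γ : L) (r l : ℕ) (δ : ℕ → Kˣ) (u : K) :
    elemV (F := F) γ r l δ u = aeval γ (twistedPoly (Fintype.card F)
      (onePlusSum (Finset.Icc 1 r \ {l}) δ) (X ^ l) u) := by
  simp only [elemV, twistedPoly, onePlusSum, map_add, map_mul, map_one, map_sum,
    aeval_C, aeval_X, map_pow]
  simp only [mul_add, Finset.mul_sum, mul_one, mul_assoc]
  ring

variable [Field F] [Algebra F K] [Algebra F L] [IsScalarTower F K L]

theorem mem_spaceU_iff (γ : L) {r p l : ℕ} (hl : 1 ≤ l) (hpl : p * l ≤ r) (θ : K) (δ : ℕ → Kˣ)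
    (x : L) :
    x ∈ spaceU F γ r p l θ δ ↔ ∃ u : K, x = aeval γ (twistedPoly (Fintype.card F)
      (onePlusSum (Finset.Icc 1 r) δ) (C θ * expand K l (progressionSum p l δ)) u) := by
  simp only [← elemU_eq_aeval (F := F) γ hl hpl θ δ]
  rfl

theorem mem_spaceV_iff (γ : L) (r l : ℕ) (δ : ℕ → Kˣ) (x : L) :
    x ∈ spaceV F γ r l δ ↔ ∃ u : K, x = aeval γ (twistedPoly (Fintype.card F)
      (onePlusSum (Finset.Icc 1 r \ {l}) δ) (X ^ l) u) := by
  simp only [← elemV_eq_aeval (F := F) γ r l δ]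
  rfl

theorem spaceU_congr (γ : L) {r p l : ℕ} (hl : 1 ≤ l) (hpl : p * l ≤ r) (θ : K) {δ δ' : ℕ → Kˣ}
    (h : ∀ n ∈ Finset.Icc 1 r, δ n = δ' n) :
    spaceU F γ r p l θ δ = spaceU F γ r p l θ δ' := by
  have hprog : progressionSum p l δ = progressionSum p l δ' := by
    refine Finset.sum_congr rfl fun a ha => ?_
    obtain ⟨ha1, hap⟩ := Finset.mem_Icc.1 ha
    have h3 : a * l ≤ p * l := Nat.mul_le_mul_right l hap
    have h4 : 1 * 1 ≤ a * l := Nat.mul_le_mul ha1 hl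
    rw [h _ (Finset.mem_Icc.2 (by omega))]
  ext x
  rw [mem_spaceU_iff γ hl hpl, mem_spaceU_iff γ hl hpl, onePlusSum_congr h, hprog]

theorem spaceV_congr (γ : L) {r l : ℕ} {δ δ' : ℕ → Kˣ}
    (h : ∀ n ∈ Finset.Icc 1 r \ {l}, δ n = δ' n) :
    spaceV F γ r l δ = spaceV F γ r l δ' := by
  ext x
  rw [mem_spaceV_iff, mem_spaceV_iff, onePlusSum_congr h]

end Spaces

/-! ### Counting the admissible pairs -/

/-- The possible values of `l` for a given `p`. -/
def stepRange (r p : ℕ) : Finset ℕ :=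
  if p = 1 then Finset.Ioo 0 r else Finset.Ioo ⌊(r : ℚ) / (p + 1)⌋₊ ⌈(r : ℚ) / p⌉₊

/-- The admissible pairs `(p, l)`. -/
noncomputable def admissiblePairs (r : ℕ) : Finset (Σ _ : ℕ, ℕ) :=
  (Finset.Icc 1 (pZero r)).sigma (stepRange r)

theorem mem_admissiblePairs {r p l : ℕ} :
    (⟨p, l⟩ : Σ _ : ℕ, ℕ) ∈ admissiblePairs r ↔ IsAdmissiblePair r p l := by
  rw [admissiblePairs, Finset.mem_sigma, Finset.mem_Icc, IsAdmissiblePair, and_assoc, stepRange]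
  refine and_congr_right fun _ => and_congr_right fun _ => ?_
  dsimp only
  split_ifs
  · simp [Nat.one_le_iff_ne_zero, Nat.pos_iff_ne_zero]
  · rw [Finset.mem_Ioo, Nat.floor_lt (by positivity), Nat.lt_ceil]

theorem one_le_pZero {r : ℕ} (hr : 2 ≤ r) : 1 ≤ pZero r := by
  rcases hr.eq_or_lt with rfl | h
  · simp [pZero]
  · exact (pZero_isGreatest h).1.1

theorem card_stepRange_of_ne_one {r p : ℕ} (hp : 1 ≤ p) (hp1 : p ≠ 1) (hr : 0 < r) :
    ((stepRange r p).card : ℚ) = (⌈(r : ℚ) / p⌉ : ℚ) - (⌊(r : ℚ) / (p + 1)⌋ : ℚ) - 1 := by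
  have hp0 : (0 : ℚ) < p := by exact_mod_cast hp
  have hr0 : (0 : ℚ) < r := by exact_mod_cast hr
  -- The strict inequality keeps the natural subtraction in the cardinality of the open interval
  -- from truncating.
  have hlt : ⌊(r : ℚ) / (p + 1)⌋₊ < ⌈(r : ℚ) / p⌉₊ := by
    rw [Nat.lt_ceil]
    refine (Nat.floor_le (by positivity)).trans_lt ?_
    exact div_lt_div_of_pos_left hr0 hp0 (by linarith)
  rw [stepRange, if_neg hp1, Nat.card_Ioo, Nat.cast_sub (by omega), Nat.cast_sub hlt.le,
    natCast_ceil_eq_intCast_ceil (by positivity), natCast_floor_eq_intCast_floor (by positivity),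
    Nat.cast_one]

theorem card_admissiblePairs {r : ℕ} (hr : 2 ≤ r) :
    ((admissiblePairs r).card : ℚ) = (r : ℚ) - 1
      + ∑ i ∈ Finset.Icc 2 (pZero r), ((⌈(r : ℚ) / i⌉ : ℚ) - (⌊(r : ℚ) / (i + 1)⌋ : ℚ) - 1) := by
  rw [admissiblePairs, Finset.card_sigma, ← Finset.insert_Icc_add_one_left_eq_Icc (one_le_pZero hr),
    Finset.sum_insert (by simp), Nat.cast_add, Nat.cast_sum]
  congr 1
  · rw [stepRange, if_pos rfl, Nat.card_Ioo, Nat.sub_zero, Nat.cast_sub (by omega), Nat.cast_one]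
  · refine Finset.sum_congr rfl fun p hp => card_stepRange_of_ne_one ?_ ?_ (by omega) <;>
    · rw [Finset.mem_Icc] at hp
      omega

theorem IsAdmissiblePair.isStepPair {r p l : ℕ} (h : IsAdmissiblePair r p l) :
    IsStepPair r p l := by
  obtain ⟨hp, -, h⟩ := h
  refine ⟨hp, ?_⟩
  split_ifs at h with hp1
  · subst hp1
    exact ⟨h.1, by omega, fun h => absurd rfl h⟩
  · obtain ⟨h1, h2⟩ := h
    have hp0 : (0 : ℚ) < p := by exact_mod_cast hp
    rw [div_lt_iff₀ (by positivity)] at h1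
    rw [lt_div_iff₀ hp0] at h2
    have h1' : r < l * (p + 1) := by exact_mod_cast h1
    have h2' : l * p < r := by exact_mod_cast h2
    refine ⟨?_, by rwa [mul_comm], fun _ => by rwa [mul_comm]⟩
    rw [Nat.one_le_iff_ne_zero]
    rintro rfl
    omega

/-! ### Normalised coefficient sequences -/

section Sequences

variable {G : Type*} [One G]

/-- Extend a family indexed by `E` by `1`. -/
def extendByOne (E : Finset ℕ) (g : ∀ n ∈ E, G) (n : ℕ) : G :=
  if h : n ∈ E then g n h else 1

theorem extendByOne_injective (E : Finset ℕ) :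
    Function.Injective (extendByOne E : (∀ n ∈ E, G) → ℕ → G) := by
  intro g g' h
  funext n hn
  simpa [extendByOne, hn] using congrFun h n

variable [Fintype G]

/-- The sequences with entries in `A` at `r`, arbitrary entries at the other places of `E`, and
entries `1` outside `E`. -/
def sequencesOn (E : Finset ℕ) (r : ℕ) (A : Finset G) : Finset (ℕ → G) :=
  (E.pi fun e => if e = r then A else Finset.univ).map
    ⟨extendByOne E, extendByOne_injective E⟩

theorem mem_sequencesOn {E : Finset ℕ} {r : ℕ} (hr : r ∈ E) {A : Finset G} {δ : ℕ → G} :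
    δ ∈ sequencesOn E r A ↔ δ r ∈ A ∧ ∀ n ∉ E, δ n = 1 := by
  rw [sequencesOn, Finset.mem_map]
  constructor
  · rintro ⟨g, hg, rfl⟩
    rw [Finset.mem_pi] at hg
    change extendByOne E g r ∈ A ∧ ∀ n ∉ E, extendByOne E g n = 1
    exact ⟨by simpa [extendByOne, hr] using hg r hr, fun n hn => by simp [extendByOne, hn]⟩
  · rintro ⟨h1, h2⟩
    refine ⟨fun n _ => δ n, Finset.mem_pi.2 fun n _ => ?_, ?_⟩
    · split_ifs with h
      · exact h ▸ h1
      · exact Finset.mem_univ _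
    · change extendByOne E (fun n _ => δ n) = δ
      funext n
      rw [extendByOne]
      split_ifs with h
      · rfl
      · exact (h2 n h).symm

theorem card_sequencesOn {E : Finset ℕ} {r : ℕ} (hr : r ∈ E) (A : Finset G) :
    (sequencesOn E r A).card = A.card * Fintype.card G ^ (E.card - 1) := by
  rw [sequencesOn, Finset.card_map, Finset.card_pi, ← Finset.mul_prod_erase _ _ hr, if_pos rfl]
  congr 1
  rw [← Finset.card_erase_of_mem hr, ← Finset.prod_const]
  exact Finset.prod_congr rfl fun e he => by rw [if_neg (Finset.ne_of_mem_erase he), Finset.card_univ]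

theorem exists_mem_sequencesOn_eqOn {E : Finset ℕ} {r : ℕ} (hr : r ∈ E) {A : Finset G}
    {δ : ℕ → G} (hδ : δ r ∈ A) : ∃ δ' ∈ sequencesOn E r A, ∀ n ∈ E, δ n = δ' n := by
  refine ⟨fun n => if n ∈ E then δ n else 1, (mem_sequencesOn hr).2 ⟨by simpa [hr] using hδ,
    fun n hn => by simp [hn]⟩, fun n hn => by simp [hn]⟩

theorem eq_of_mem_sequencesOn {E : Finset ℕ} {r : ℕ} (hr : r ∈ E) {A : Finset G} {δ δ' : ℕ → G}
    (hδ : δ ∈ sequencesOn E r A) (hδ' : δ' ∈ sequencesOn E r A) (h : ∀ n ∈ E, δ n = δ' n) :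
    δ = δ' := by
  funext n
  by_cases hn : n ∈ E
  · exact h n hn
  · rw [((mem_sequencesOn hr).1 hδ).2 n hn, ((mem_sequencesOn hr).1 hδ').2 n hn]

end Sequences

/-! ### Power classes in a cyclic group, and the avoiding set -/

/-- Since m divides the group order, exponents of the generator are well defined modulo m, and m-th
powers have exponent 0 there. With m = q - 1 this separates the values of θ. -/
theorem eq_of_pow_eq_pow_mul_pow {G : Type*} [CommGroup G] {ξ : G}
    (hξ : ∀ x : G, x ∈ Subgroup.zpowers ξ) {m : ℕ} (hm : m ∣ Nat.card G) {i j : ℕ}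
    (hi : i < m) (hj : j < m) {μ : G} (h : ξ ^ j = μ ^ m * ξ ^ i) : i = j := by
  obtain ⟨a, rfl⟩ := Subgroup.mem_zpowers_iff.1 (hξ μ)
  have h1 : ξ ^ ((j : ℤ) - i - a * m) = 1 := by
    rw [zpow_sub, zpow_sub, zpow_natCast, zpow_natCast, zpow_mul, zpow_natCast, h]
    group
  have h2 : (m : ℤ) ∣ (j : ℤ) - i - a * m := by
    refine dvd_trans ?_ (orderOf_dvd_iff_zpow_eq_one.2 h1)
    rw [orderOf_eq_card_of_forall_mem_zpowers hξ]
    exact_mod_cast hm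
  have h3 : (m : ℤ) ∣ (j : ℤ) - i := by
    have := dvd_add h2 (dvd_mul_left (m : ℤ) a)
    rwa [sub_add_cancel] at this
  have h4 := Int.eq_zero_of_abs_lt_dvd h3 (by rw [abs_lt]; omega)
  omega

/-- Take an avoiding set A of maximal size. A unit x outside A cannot be added, so x = (cα)⁻¹ for
some α in A, or c x² = 1, which has at most two solutions. Hence |K| - 1 ≤ 2|A| + 2, and A has a
subset of the required size. -/
theorem exists_isAvoidingSet {K : Type*} [Field K] [Fintype K] {c : K} (hc : c ≠ 0) :
    ∃ A : Finset Kˣ, IsAvoidingSet c ((Fintype.card K - 2) / 2) A := by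
  classical
  let P : Finset Kˣ → Prop := fun A => ∀ α ∈ A, ∀ β ∈ A, c * (α : K) * (β : K) ≠ 1
  obtain ⟨A, hA, hmax⟩ := Finset.exists_max_image (Finset.univ.filter P) Finset.card
    ⟨∅, by simp [P]⟩
  have hPA : P A := by simpa using hA
  let σ : Kˣ → Kˣ := fun α => (Units.mk0 c hc * α)⁻¹
  let S : Finset Kˣ := Finset.univ.filter fun α => c * (α : K) * α = 1
  have hS : S.card ≤ 2 := by
    have h1 : S.card = (S.image fun α : Kˣ => (α : K)).card :=
      (Finset.card_image_of_injective _ Units.val_injective).symm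
    rw [h1]
    have h2 : (S.image fun α : Kˣ => (α : K)) ⊆ (Polynomial.nthRoots 2 c⁻¹).toFinset := by
      intro x hx
      obtain ⟨α, hα, rfl⟩ := Finset.mem_image.1 hx
      have hα' : c * (α : K) * α = 1 := by simpa [S] using hα
      rw [Multiset.mem_toFinset, Polynomial.mem_nthRoots two_pos]
      field_simp
      linear_combination hα'
    exact (Finset.card_le_card h2).trans
      ((Multiset.toFinset_card_le _).trans (Polynomial.card_nthRoots _ _))
  have hcover : (Finset.univ : Finset Kˣ) ⊆ A ∪ A.image σ ∪ S := by
    intro x _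
    by_contra hx
    simp only [Finset.mem_union, not_or] at hx
    obtain ⟨⟨hxA, hxσ⟩, hxS⟩ := hx
    have hxx : c * (x : K) * x ≠ 1 := by simpa [S] using hxS
    have hne : ∀ α ∈ A, c * (α : K) * x ≠ 1 := by
      intro α hα h1
      refine hxσ (Finset.mem_image.2 ⟨α, hα, ?_⟩)
      rw [inv_eq_iff_mul_eq_one]
      exact Units.ext (by simpa using h1)
    have hP : P (insert x A) := by
      intro α hα β hβ
      rw [Finset.mem_insert] at hα hβ
      rcases hα with rfl | hα <;> rcases hβ with rfl | hβ
      · exact hxx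
      · rw [mul_right_comm]
        exact hne β hβ
      · exact hne α hα
      · exact hPA α hα β hβ
    have := hmax (insert x A) (by simpa using hP)
    rw [Finset.card_insert_of_notMem hxA] at this
    omega
  have hcard := Finset.card_le_card hcover
  have h1 := Finset.card_union_le (A ∪ A.image σ) S
  have h2 := Finset.card_union_le A (A.image σ)
  have h3 := Finset.card_image_le (s := A) (f := σ)
  rw [Finset.card_univ, Fintype.card_units] at hcard
  obtain ⟨B, hBA, hB⟩ := Finset.exists_subset_card_eq
    (show (Fintype.card K - 2) / 2 ≤ A.card by omega)
  exact ⟨B, hB, fun α hα β hβ => hPA α (hBA hα) β (hBA hβ)⟩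

/-! ### Parameters of the code and their injectivity -/

section Index

open Polynomial

variable {K : Type*} [Field K]

/-- The parameters of the spaces of the code: `((p, l), j, δ)` for the spaces `U` and `(l, δ)` for
the spaces `V`. -/
abbrev CodeIndex (K : Type*) [Field K] : Type _ :=
  ((Σ _ : ℕ, ℕ) × ℕ × (ℕ → Kˣ)) ⊕ (Σ _ : ℕ, ℕ → Kˣ)

/-- The parameters that occur, with `δ` equal to `1` at the places that do not matter. -/
noncomputable def codeIndices [Fintype Kˣ] (r q : ℕ) (A : Finset Kˣ) : Finset (CodeIndex K) :=
  (admissiblePairs r ×ˢ Finset.range (q - 1) ×ˢ sequencesOn (Finset.Icc 1 r) r A).disjSum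
    ((Finset.Ioo 0 r).sigma fun l => sequencesOn (Finset.Icc 1 r \ {l}) r A)

/-- The first polynomial attached to a parameter. -/
noncomputable def leftPoly (r : ℕ) : CodeIndex K → K[X] :=
  Sum.elim (fun i => onePlusSum (Finset.Icc 1 r) i.2.2)
    (fun i => onePlusSum (Finset.Icc 1 r \ {i.1}) i.2)

/-- The second polynomial attached to a parameter. -/
noncomputable def rightPoly (ξ : Kˣ) : CodeIndex K → K[X] :=
  Sum.elim (fun i => C ((ξ : K) ^ i.2.1) * expand K i.1.2 (progressionSum i.1.1 i.1.2 i.2.2))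
    (fun i => X ^ i.1)

variable [Fintype Kˣ] {r q : ℕ} {A : Finset Kˣ}

theorem inl_mem_codeIndices {p l j : ℕ} {δ : ℕ → Kˣ} :
    (Sum.inl (⟨p, l⟩, j, δ) : CodeIndex K) ∈ codeIndices r q A ↔
      IsAdmissiblePair r p l ∧ j < q - 1 ∧ δ ∈ sequencesOn (Finset.Icc 1 r) r A := by
  simp [codeIndices, mem_admissiblePairs]

theorem inr_mem_codeIndices {l : ℕ} {δ : ℕ → Kˣ} :
    (Sum.inr ⟨l, δ⟩ : CodeIndex K) ∈ codeIndices r q A ↔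
      (0 < l ∧ l < r) ∧ δ ∈ sequencesOn (Finset.Icc 1 r \ {l}) r A := by
  simp [codeIndices]

theorem card_codeIndices (hr : 2 ≤ r) (q : ℕ) (A : Finset Kˣ) :
    (codeIndices r q A).card
      = (admissiblePairs r).card * ((q - 1) * (A.card * Fintype.card Kˣ ^ (r - 1)))
        + (r - 1) * (A.card * Fintype.card Kˣ ^ (r - 2)) := by
  rw [codeIndices, Finset.card_disjSum, Finset.card_product, Finset.card_product,
    Finset.card_range, card_sequencesOn (by simp; omega), Nat.card_Icc, Nat.add_sub_cancel,
    Finset.card_sigma]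
  congr 1
  have hcard : ∀ l ∈ Finset.Ioo 0 r, (sequencesOn (Finset.Icc 1 r \ {l}) r A).card
      = A.card * Fintype.card Kˣ ^ (r - 2) := by
    intro l hl
    rw [Finset.mem_Ioo] at hl
    rw [card_sequencesOn (by simp; omega), Finset.card_sdiff_of_subset (by simp; omega),
      Nat.card_Icc, Finset.card_singleton]
    rfl
  rw [Finset.sum_congr rfl hcard, Finset.sum_const, Nat.card_Ioo, smul_eq_mul, Nat.sub_zero]

theorem isTwistPair_of_mem_codeIndices (ξ : Kˣ) {i : CodeIndex K}
    (hi : i ∈ codeIndices r q A) : IsTwistPair r (leftPoly r i) (rightPoly ξ i) := by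
  rcases i with ⟨⟨p, l⟩, j, δ⟩ | ⟨l, δ⟩
  · obtain ⟨hpl, -, -⟩ := inl_mem_codeIndices.1 hi
    obtain ⟨hp1, hl1, hplr, -⟩ := hpl.isStepPair
    exact isTwistPair_onePlusSum_progressionSum (by omega) hp1 hl1 hplr
      (pow_ne_zero _ ξ.ne_zero) δ
  · obtain ⟨⟨hl, hlr⟩, -⟩ := inr_mem_codeIndices.1 hi
    exact isTwistPair_onePlusSum_X_pow hl hlr δ

theorem exists_coeff_leftPoly_eq (hr : 1 ≤ r) {i : CodeIndex K} (hi : i ∈ codeIndices r q A) :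
    ∃ α ∈ A, (leftPoly r i).coeff r = α := by
  rcases i with ⟨⟨p, l⟩, j, δ⟩ | ⟨l, δ⟩
  · obtain ⟨-, -, hδ⟩ := inl_mem_codeIndices.1 hi
    have hrm : r ∈ Finset.Icc 1 r := by simp [hr]
    exact ⟨δ r, ((mem_sequencesOn hrm).1 hδ).1, coeff_onePlusSum_of_mem (by simp) δ hrm⟩
  · obtain ⟨⟨hl, hlr⟩, hδ⟩ := inr_mem_codeIndices.1 hi
    have hrm : r ∈ Finset.Icc 1 r \ {l} := by simp; omega
    exact ⟨δ r, ((mem_sequencesOn hrm).1 hδ).1, coeff_onePlusSum_of_mem (by simp) δ hrm⟩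

theorem eq_of_relation_of_mem_codeIndices {ξ : Kˣ} (hξ : ∀ x : Kˣ, x ∈ Subgroup.zpowers ξ)
    (hq : q - 1 ∣ Nat.card Kˣ) {i j : CodeIndex K} (hi : i ∈ codeIndices r q A)
    (hj : j ∈ codeIndices r q A) {μ : Kˣ}
    (h : leftPoly r i * rightPoly ξ j
      = C ((μ : K) ^ (q - 1)) * (rightPoly ξ i * leftPoly r j)) : i = j := by
  have hμ : (μ : K) ^ (q - 1) ≠ 0 := pow_ne_zero _ μ.ne_zero
  have hξ0 : ∀ m : ℕ, (ξ : K) ^ m ≠ 0 := fun m => pow_ne_zero _ ξ.ne_zero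
  rcases i with ⟨⟨p, l⟩, m, δ⟩ | ⟨l, δ⟩ <;> rcases j with ⟨⟨p', l'⟩, m', δ'⟩ | ⟨l', δ'⟩
  · obtain ⟨hpl, hm, hδ⟩ := inl_mem_codeIndices.1 hi
    obtain ⟨hpl', hm', hδ'⟩ := inl_mem_codeIndices.1 hj
    obtain ⟨rfl, rfl, hθ, hδδ⟩ := eq_of_relation_progression hpl.isStepPair hpl'.isStepPair
      (hξ0 m) (hξ0 m') hμ h
    have hrm : r ∈ Finset.Icc 1 r := by
      obtain ⟨-, -, h1, -⟩ := hpl.isStepPair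
      simp; omega
    obtain rfl := eq_of_mem_sequencesOn hrm hδ hδ' hδδ
    obtain rfl := eq_of_pow_eq_pow_mul_pow hξ hq hm hm' (Units.ext (by push_cast; exact hθ))
    rfl
  · obtain ⟨hpl, -, -⟩ := inl_mem_codeIndices.1 hi
    obtain ⟨⟨hl', hlr'⟩, -⟩ := inr_mem_codeIndices.1 hj
    exact (false_of_relation_progression_X_pow hpl.isStepPair hl' hlr' (hξ0 m) hμ h).elim
  · obtain ⟨⟨hl, hlr⟩, -⟩ := inr_mem_codeIndices.1 hi
    obtain ⟨hpl', -, -⟩ := inl_mem_codeIndices.1 hj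
    -- Exchanging the two pairs replaces the constant in the relation by its inverse.
    refine (false_of_relation_progression_X_pow (δ := δ') (δ' := δ) hpl'.isStepPair hl hlr
      (hξ0 m') (inv_ne_zero hμ) ?_).elim
    apply mul_left_cancel₀ (C_ne_zero.2 hμ)
    rw [← mul_assoc (C _) (C _), ← C_mul, mul_inv_cancel₀ hμ, C_1, one_mul,
      mul_comm (onePlusSum _ δ'), mul_comm (C _ * expand K _ _)]
    exact h.symm
  · obtain ⟨⟨hl, hlr⟩, hδ⟩ := inr_mem_codeIndices.1 hi
    obtain ⟨⟨hl', hlr'⟩, hδ'⟩ := inr_mem_codeIndices.1 hj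
    obtain ⟨rfl, hδδ⟩ := eq_of_relation_X_pow hl hlr hl' hlr' hμ h
    obtain rfl := eq_of_mem_sequencesOn (by simp; omega) hδ hδ' hδδ
    rfl

end Index

/-! ### From parameters to spaces -/

section Code

open Polynomial

variable {F K L : Type*} [Field F] [Fintype F] [Field K] [Field L] [Algebra F K] [Algebra F L]
  [Algebra K L] [IsScalarTower F K L]

/-- The space attached to a parameter. -/
noncomputable def codeSpace (F : Type*) {K L : Type*} [Field F] [Fintype F] [Field K] [Field L]
    [Algebra F K] [Algebra F L] [Algebra K L] [IsScalarTower F K L] (γ : L) (r : ℕ) (ξ : Kˣ) :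
    CodeIndex K → Submodule F L :=
  Sum.elim (fun i => spaceU F γ r i.1.1 i.1.2 ((ξ : K) ^ i.2.1) i.2.2)
    (fun i => spaceV F γ r i.1 i.2)

variable [Fintype Kˣ] {r q : ℕ} {A : Finset Kˣ}

theorem mem_codeSpace_iff (γ : L) (ξ : Kˣ) {i : CodeIndex K} (hi : i ∈ codeIndices r q A) (x : L) :
    x ∈ codeSpace F γ r ξ i ↔ ∃ u : K, x = aeval γ
      (twistedPoly (Fintype.card F) (leftPoly r i) (rightPoly ξ i) u) := by
  rcases i with ⟨⟨p, l⟩, j, δ⟩ | ⟨l, δ⟩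
  · obtain ⟨hpl, -, -⟩ := inl_mem_codeIndices.1 hi
    obtain ⟨-, hl1, hplr, -⟩ := hpl.isStepPair
    exact mem_spaceU_iff γ hl1 hplr.le _ δ x
  · exact mem_spaceV_iff γ r l δ x

/-- Normalising δ loses no space: only the entries in [1, r] matter, and for V the entry at l does
not matter either. -/
theorem image_codeSpace (γ : L) (hr : 1 ≤ r) (ξ : Kˣ) (A : Finset Kˣ) :
    codeSpace F γ r ξ '' (codeIndices r (Fintype.card F) A : Set (CodeIndex K))
      = familyU F γ r ξ A ∪ familyV F γ r A := by
  have hrm : r ∈ Finset.Icc 1 r := by simp [hr]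
  ext W
  constructor
  · rintro ⟨⟨⟨p, l⟩, j, δ⟩ | ⟨l, δ⟩, hi, rfl⟩
    · obtain ⟨hpl, hj, hδ⟩ := inl_mem_codeIndices.1 hi
      exact Or.inl ⟨p, l, j, δ, hpl, hj, ((mem_sequencesOn hrm).1 hδ).1, rfl⟩
    · obtain ⟨⟨hl, hlr⟩, hδ⟩ := inr_mem_codeIndices.1 hi
      exact Or.inr ⟨l, δ, hl, hlr, ((mem_sequencesOn (by simp; omega)).1 hδ).1, rfl⟩
  · rintro (⟨p, l, j, δ, hpl, hj, hδ, rfl⟩ | ⟨l, δ, hl, hlr, hδ, rfl⟩)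
    · obtain ⟨-, hl1, hplr, -⟩ := hpl.isStepPair
      obtain ⟨δ', hδ', hδδ⟩ := exists_mem_sequencesOn_eqOn hrm hδ
      exact ⟨Sum.inl (⟨p, l⟩, j, δ'), inl_mem_codeIndices.2 ⟨hpl, hj, hδ'⟩,
        (spaceU_congr γ hl1 hplr.le _ hδδ).symm⟩
    · obtain ⟨δ', hδ', hδδ⟩ := exists_mem_sequencesOn_eqOn
        (E := Finset.Icc 1 r \ {l}) (by simp; omega) hδ
      exact ⟨Sum.inr ⟨l, δ'⟩, inr_mem_codeIndices.2 ⟨⟨hl, hlr⟩, hδ'⟩,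
        (spaceV_congr γ hδδ).symm⟩

end Code

/-! ### The theorem -/

theorem card_sub_one_dvd_card_units {F K : Type*} [Field F] [Fintype F] [Field K] [Finite K]
    [Algebra F K] : Fintype.card F - 1 ∣ Nat.card Kˣ := by
  have := Subgroup.card_dvd_of_injective (Units.map (algebraMap F K).toMonoidHom)
    (Units.map_injective (algebraMap F K).injective)
  rwa [Nat.card_units, Nat.card_eq_fintype_card] at this

open Polynomial in
theorem eval_zero_ne_zero_of_irreducible {K : Type*} [Field K] {f : K[X]} (hf : Irreducible f)
    (hdeg : f.natDegree ≠ 1) : f.eval 0 ≠ 0 := by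
  intro h
  exact hdeg (natDegree_eq_of_degree_eq_some (degree_eq_one_of_irreducible_of_root hf h))

theorem theorem3p7 {F K L : Type*} [Field F] [Fintype F] [Field K] [Field L]
    [Algebra F K] [Algebra F L] [Algebra K L] [IsScalarTower F K L]
    (q k r n : ℕ) (hq : Fintype.card F = q) (hk : 2 ≤ k) (hr : 2 ≤ r) (hn : n = 2 * r * k)
    (hK : Module.finrank F K = k) (hL : Module.finrank F L = n)
    (ξ : Kˣ) (hξ : ∀ x : Kˣ, x ∈ Subgroup.zpowers ξ)
    (f : K[X]) (hf_irr : Irreducible f) (hf_monic : f.Monic) (hf_deg : f.natDegree = 2 * r)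
    (γ : L) (hγ : Polynomial.aeval γ f = 0) :
    (∃ A : Finset Kˣ, IsAvoidingSet (f.eval 0) ((q ^ k - 2) / 2) A) ∧
    ∀ A : Finset Kˣ, IsAvoidingSet (f.eval 0) ((q ^ k - 2) / 2) A →
      (∀ W ∈ familyU F γ r ξ A ∪ familyV F γ r A, IsSidonSpace W) ∧
      IsCyclicCDC n (2 * k - 2) k (unionCode F γ r ξ A) ∧
      (unionCode F γ r ξ A).Finite ∧
      ((unionCode F γ r ξ A).ncard : ℚ) =
        (((r : ℚ) - 1
            + ∑ i ∈ Finset.Icc 2 (pZero r),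
                ((⌈(r : ℚ) / i⌉ : ℚ) - (⌊(r : ℚ) / (i + 1)⌋ : ℚ) - 1))
            * ((q : ℚ) ^ k - 1) * ((q : ℚ) - 1) + ((r : ℚ) - 1))
          * ((q : ℚ) ^ k - 1) ^ (r - 2) * (((q ^ k - 2) / 2 : ℕ) : ℚ)
          * ((q : ℚ) ^ n - 1) / ((q : ℚ) - 1) := by
  subst hq
  have hnpos : 0 < n := by
    rw [hn]
    positivity
  have : FiniteDimensional F K := Module.finite_of_finrank_pos (by omega)
  have : FiniteDimensional F L := Module.finite_of_finrank_pos (by omega)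
  have : Finite K := Module.finite_of_finite F
  have : Finite L := Module.finite_of_finite F
  have := Fintype.ofFinite K
  have := Fintype.ofFinite Kˣ
  have hKcard : Fintype.card K = Fintype.card F ^ k := by
    rw [← hK]
    exact Module.card_eq_pow_finrank
  have hKucard : Fintype.card Kˣ = Fintype.card F ^ k - 1 := by
    rw [← Nat.card_eq_fintype_card, Nat.card_units, Nat.card_eq_fintype_card, hKcard]
  have hLcard : Nat.card L = Fintype.card F ^ n := by
    rw [← hL, ← Nat.card_eq_fintype_card]
    exact Module.natCard_eq_pow_finrank
  have hq2 : 2 ≤ Fintype.card F := Fintype.one_lt_card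
  -- The bound q^k ≥ 4 makes (q^k - 2)/2 positive, so A, and with it the code, is nonempty.
  have hq4 : 2 ^ 2 ≤ Fintype.card F ^ k :=
    (Nat.pow_le_pow_left hq2 2).trans (Nat.pow_le_pow_right (by omega) hk)
  refine ⟨?_, fun A hA => ?_⟩
  · rw [← hKcard]
    exact exists_isAvoidingSet (eval_zero_ne_zero_of_irreducible hf_irr (by omega))
  obtain ⟨hAcard, hAne⟩ := hA
  set J := codeIndices r (Fintype.card F) A with hJ
  have himage : codeSpace F γ r ξ '' (J : Set (CodeIndex K))
      = familyU F γ r ξ A ∪ familyV F γ r A := image_codeSpace γ (by omega) ξ A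
  have hrank : ∀ i ∈ J, Module.finrank F (codeSpace F γ r ξ i) = k := fun i hi => by
    rw [← hK]
    exact finrank_eq_of_twistedPoly (by omega) hf_irr hf_monic hf_deg hγ
      (isTwistPair_of_mem_codeIndices ξ hi) (mem_codeSpace_iff γ ξ hi)
  have hsep : ∀ {i j : CodeIndex K}, i ∈ J → j ∈ J → ∀ {a b c d : L},
      a ∈ codeSpace F γ r ξ i → b ∈ codeSpace F γ r ξ i → c ∈ codeSpace F γ r ξ j →
      d ∈ codeSpace F γ r ξ j → a ≠ 0 → b ≠ 0 → c ≠ 0 → a * d = b * c →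
      (∃ e : F, a = e • b) ∨ (i = j ∧ ∃ e : F, a = e • c) := fun {i j} hi hj => by
    refine orbitSeparated_image (J := (J : Set (CodeIndex K))) hf_irr hf_monic hf_deg hγ
      (fun i hi => isTwistPair_of_mem_codeIndices ξ hi) ?_
      (fun i hi j hj μ h => eq_of_relation_of_mem_codeIndices hξ
        (card_sub_one_dvd_card_units (F := F)) hi hj h)
      (fun i hi => mem_codeSpace_iff γ ξ hi) hi hj
    intro i hi j hj
    obtain ⟨α, hα, hiα⟩ := exists_coeff_leftPoly_eq (by omega) hi
    obtain ⟨β, hβ, hjβ⟩ := exists_coeff_leftPoly_eq (by omega) hj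
    rw [hiα, hjβ]
    exact hAne α hα β hβ
  have hinj : Set.InjOn (codeSpace F γ r ξ) (J : Set (CodeIndex K)) := by
    intro i hi j hj hij
    obtain ⟨a, ha, b, hb, ha0, hb0, hab⟩ := Submodule.exists_not_proportional
      (W := codeSpace F γ r ξ i) (by rw [hrank i hi]; exact hk)
    -- Separation is stated for parameters, so applying it to a b = b a inside one space shows that
    -- its parameter is unique.
    rcases hsep hi hj ha hb (hij ▸ ha) (hij ▸ hb) ha0 hb0 ha0 (mul_comm a b) with ⟨e, he⟩ | h
    · exact absurd he (hab e)
    · exact h.1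
  have hS : OrbitSeparated (familyU F γ r ξ A ∪ familyV F γ r A) := by
    rw [← himage]
    rintro _ ⟨i, hi, rfl⟩ _ ⟨j, hj, rfl⟩ a ha b hb c hc d hd ha0 hb0 hc0 - habcd
    exact (hsep hi hj ha hb hc hd ha0 hb0 hc0 habcd).imp_right
      fun h => ⟨congrArg _ h.1, h.2⟩
  have hdim : ∀ W ∈ familyU F γ r ξ A ∪ familyV F γ r A, Module.finrank F W = k := by
    rw [← himage]
    rintro _ ⟨i, hi, rfl⟩
    exact hrank i hi
  have hne : (familyU F γ r ξ A ∪ familyV F γ r A).Nonempty := by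
    obtain ⟨α, hα⟩ : A.Nonempty := Finset.card_pos.1 (by omega)
    exact ⟨_, Or.inr ⟨1, fun _ => α, le_rfl, by omega, hα, rfl⟩⟩
  refine ⟨fun W hW => hS.isSidonSpace hW, ?_, Set.toFinite _, ?_⟩
  · rw [← hL]
    exact hS.isCyclicCDC hne hk hdim
  · have hcount := hS.ncard_mul fun W hW => (hdim W hW).ge.trans' hk
    rw [← himage, hinj.ncard_image, himage, Set.ncard_coe_finset, Nat.card_units,
      Nat.card_units, hLcard, Nat.card_eq_fintype_card, hJ, card_codeIndices hr,
      hKucard, hAcard] at hcount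
    have hcount' := congrArg (Nat.cast : ℕ → ℚ) hcount
    have h1 : 1 ≤ Fintype.card F ^ k := by omega
    have h2 : 1 ≤ Fintype.card F ^ n := Nat.one_le_pow _ _ (by omega)
    push_cast [Nat.cast_sub (show 1 ≤ Fintype.card F by omega), Nat.cast_sub h1, Nat.cast_sub h2,
      Nat.cast_sub (show 1 ≤ r by omega), card_admissiblePairs hr] at hcount'
    have hq1 : (Fintype.card F : ℚ) - 1 ≠ 0 := by
      have : (2 : ℚ) ≤ Fintype.card F := by exact_mod_cast hq2
      linarith
    -- The U-spaces carry one more free coefficient than the V-spaces; splitting off this factor q^k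
    -- - 1 exposes the common power r - 2.
    rw [eq_div_iff hq1, unionCode, hcount', show r - 1 = r - 2 + 1 by omega, pow_succ]
    ring
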